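/- **Setting.** Let $N\ge 1$, let $\Omega\subset\mathbb R^N$ be open and bounded, $T>0$, $Q_T=\Omega\times(0,T]$, let $B$ be the open unit ball of $\mathbb R^N$ and $\mathbb S^N$ the set of real symmetric $N\times N$ matrices. Let $\mu$ be a Lévy measure, i.e. a nonnegative Borel measure on $\mathbb R^N$ with $\int\min(|z|^2,1)\,\mu(dz)<\infty$, and let $j:\Omega\times\mathbb R^N\to\mathbb R^N$ be Borel in $z$ with $|j(x,z)|\le C_0|z|$ for all $x\in\Omega$, $z\in\mathbb R^N$ and some constant $C_0>0$. Consider $$u_t+F(x,t,Du,D^2u,\mathcal J[x,t,u])=0,\qquad \mathcal J[x,t,u]=\int_{\mathbb R^N}\big(u(x+j(x,z),t)-u(x,t)-Du(x,t)\cdot j(x,z)1_B(z)\big)\mu(dz).$$ **Subsolutions.** For $0<\delta<1$ put $$\mathcal J^1_\delta[x,t,\phi]=\int_{|z|\le\delta}\big(\phi(x+j(x,z),t)-\phi(x,t)-D\phi(x,t)\cdot j(x,z)1_B(z)\big)\mu(dz),$$ $$\mathcal J^2_\delta[x,t,p,u]=\int_{|z|>\delta}\big(u(x+j(x,z),t)-u(x,t)-p\cdot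 j(x,z)1_B(z)\big)\mu(dz).$$ For $I\subset(0,T]$, a function $u\in USC(\mathbb R^N\times[0,T])$ is a viscosity subsolution in $\Omega\times I$ if, whenever $\phi$ is $C^2$ and $u-\phi$ has a maximum over $\mathbb R^N\times[0,T]$ at a point $(x,t)\in\Omega\times I$, for every $\delta\in(0,1)$ the integral $\mathcal J^2_\delta[x,t,D\phi(x,t),u]$ converges absolutely and $$\phi_t(x,t)+F\big(x,t,D\phi(x,t),D^2\phi(x,t),\mathcal J^1_\delta[x,t,\phi]+\mathcal J^2_\delta[x,t,D\phi(x,t),u]\big)\le0 .$$ **Assumptions.** Points $x$ range over $\Omega$ and times $t$ over $[0,T]$. * $(M_{LI})$: $\tilde C_\mu>0$ is a constant with $\int_B|j(x,z)|^2\mu(dz)+\mu(\mathbb R^N\setminus B)\le\tilde C_\mu$ for all $x\in\Omega$. * $(E)$: $F$ is continuous on $\Omega\times[0,T]\times\mathbb R^N\times\mathbb S^N\times\mathbb R$, and $F(x,t,p,X,l_1)\le F(x,t,p,Y,l_2)$ whenever $p\ne0$, $X\ge Y$, $l_1\ge l_2$. * $(S)$: for any $\bar x\in\Omega$, $t_0\in(0,T)$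 there are $R_0,\varepsilon_0,\gamma_0>0$ such that for all $0<R<R_0$, $0<\varepsilon<\varepsilon_0$, $\gamma\ge\gamma_0$, $|x-\bar x|\le R$, $|t-t_0|\le R$, $R/2\le|p|\le R$ and $l\in\mathbb R$, $$F(x,t,\varepsilon p,\varepsilon(I-\gamma p\otimes p),\varepsilon l)\ge\varepsilon F(x,t,p,I-\gamma p\otimes p,l).$$ * $(S')$: for any $(x_0,t_0)\in Q_T$ there are $r_0,\varepsilon_0>0$ such that for all $0<\varepsilon<\varepsilon_0$, $0<r<r_0$, $(x,t)\in B((x_0,t_0),r)$, $|p|\le r$ and $l\le\tilde C_\mu$, $F(x,t,\varepsilon p,\varepsilon I,\varepsilon l)\ge\varepsilon F(x,t,p,I,l)$. * $(N_{LI})$: for any $\bar x\in\Omega$, $t_0\in(0,T)$ there are $R_0>0$ and $0<\eta<1$ such that for any $0<R<R_0$ and $c>0$, $$F\Big(x,t,p,I-\gamma p\otimes p,\ \tilde C_\mu-c\gamma\int_{\mathcal C_{\eta,\gamma}(p)}|p\cdot j(x,z)|^2\mu(dz)\Big)\to+\infty\quad\text{as }\gamma\to+\infty,$$ uniformly for $|x-\bar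 x|\le R$, $|t-t_0|\le R$, $R/2\le|p|\le R$, where $\mathcal C_{\eta,\gamma}(p)=\{z:(1-\eta)|j(x,z)||p|\le|p\cdot j(x,z)|\le1/\gamma\}$. * $(N')$: for any $(x_0,t_0)\in Q_T$ there is $\lambda>0$ with $\lambda+F(x_0,t_0,0,I,\tilde C_\mu)>0$. For $P_0\in Q_T$ let $S(P_0)$ be the set of points $Q\in Q_T$ that can be joined to $P_0$ by a simple continuous curve in $Q_T$ (possibly reduced to a point) along which the time coordinate is nondecreasing from $Q$ to $P_0$. **Theorem (Strong Maximum Principle, Lévy–Itô).** Assume $(M_{LI})$, $(E)$, $(S)$, $(S')$, $(N_{LI})$ and $(N')$. Let $u\in USC(\mathbb R^N\times[0,T])$ be a viscosity subsolution in $\Omega\times(0,T)$ that attains its maximum over $\mathbb R^N\times[0,T]$ at $P_0=(x_0,t_0)\in Q_T$; if $t_0=T$, assume moreover that $u$ is a viscosity subsolution in $\Omega\times(0,T]$. Then $u$ is constant in $S(P_0)$, i.e. $u(Q)=u(P_0)$ for all $Q\in S(P_0)$. -/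

import Mathlib

open MeasureTheory Set Filter Topology

namespace LevyIto

noncomputable section

/-- The Euclidean space `ℝ^N`. -/
abbrev Space (N : ℕ) := EuclideanSpace ℝ (Fin N)

/-- Nonlinearities `F(x, t, p, X, l)`. Only the values with `x ∈ Ω`, `t ∈ [0, T]` and `X` a
symmetric matrix are ever constrained or used. -/
abbrev Nonlinearity (N : ℕ) :=
  Space N → ℝ → Space N → Matrix (Fin N) (Fin N) ℝ → ℝ → ℝ

/-- The open unit ball `B` of `ℝ^N`. -/
def unitBall (N : ℕ) : Set (Space N) := Metric.ball 0 1

/-- The closed space-time strip `ℝ^N × [0, T]` on which the functions `u` are given. -/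
def strip (N : ℕ) (T : ℝ) : Set (Space N × ℝ) := univ ×ˢ Icc 0 T

/-- `Q_T = Ω × (0, T]`. -/
def parabolicCylinder {N : ℕ} (Ω : Set (Space N)) (T : ℝ) : Set (Space N × ℝ) := Ω ×ˢ Ioc 0 T

/-- `S(P₀)`: the points `Q` of `Q_T` that can be joined to `P₀` by a simple continuous curve in
`Q_T` along which time is nondecreasing from `Q` to `P₀` (`P₀` itself being joined to `P₀` by
the degenerate curve). -/
def reachableSet {N : ℕ} (Ω : Set (Space N)) (T : ℝ) (P₀ : Space N × ℝ) :
    Set (Space N × ℝ) :=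
  {Q | Q ∈ parabolicCylinder Ω T ∧ (Q = P₀ ∨ ∃ γ : ℝ → Space N × ℝ,
    ContinuousOn γ (Icc 0 1) ∧ InjOn γ (Icc 0 1) ∧ γ 0 = Q ∧ γ 1 = P₀ ∧
    (∀ s ∈ Icc (0 : ℝ) 1, γ s ∈ parabolicCylinder Ω T) ∧
    MonotoneOn (fun s => (γ s).2) (Icc 0 1))}

/-- Lévy measures: nonnegative Borel measures with `∫ min(|z|², 1) μ(dz) < ∞`. -/
def IsLevyMeasure {N : ℕ} (μ : Measure (Space N)) : Prop :=
  ∫⁻ z, ENNReal.ofReal (min (‖z‖ ^ 2) 1) ∂μ < ⊤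

/-- Jump functions: `j(x, ·)` is Borel and `|j(x, z)| ≤ C₀ |z|` for `x ∈ Ω`. -/
def IsJumpFunction {N : ℕ} (Ω : Set (Space N)) (j : Space N → Space N → Space N) : Prop :=
  (∀ x ∈ Ω, Measurable (j x)) ∧
  ∃ C₀ : ℝ, 0 < C₀ ∧ ∀ x ∈ Ω, ∀ z, ‖j x z‖ ≤ C₀ * ‖z‖

/-- Assumption `(M_LI)` with constant `Cμ`:
`∫_B |j(x,z)|² μ(dz) + μ(ℝ^N ∖ B) ≤ Cμ` for all `x ∈ Ω`. -/
def AssumptionM {N : ℕ} (Ω : Set (Space N)) (μ : Measure (Space N))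
    (j : Space N → Space N → Space N) (Cμ : ℝ) : Prop :=
  0 < Cμ ∧ ∀ x ∈ Ω,
    (∫⁻ z in unitBall N, ENNReal.ofReal (‖j x z‖ ^ 2) ∂μ) + μ (unitBall N)ᶜ ≤ ENNReal.ofReal Cμ

/-- The vector `1_B(z) j(x, z)` of the compensator. -/
def cutJump {N : ℕ} (j : Space N → Space N → Space N) (x z : Space N) : Space N :=
  (unitBall N).indicator (j x) z

/-- The integrand `w(x + j(x,z), t) - w(x,t) - p · j(x,z) 1_B(z)`. -/
def jumpIncrement {N : ℕ} (j : Space N → Space N → Space N) (x : Space N) (t : ℝ)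
    (p : Space N) (w : Space N × ℝ → ℝ) (z : Space N) : ℝ :=
  w (x + j x z, t) - w (x, t) - inner ℝ p (cutJump j x z)

/-- The spatial gradient `Dφ(x,t)`. -/
def spaceGrad {N : ℕ} (φ : Space N × ℝ → ℝ) (x : Space N) (t : ℝ) : Space N :=
  gradient (fun y => φ (y, t)) x

/-- The spatial Hessian matrix `D²φ(x,t)`. -/
def spaceHess {N : ℕ} (φ : Space N × ℝ → ℝ) (x : Space N) (t : ℝ) :
    Matrix (Fin N) (Fin N) ℝ :=
  Matrix.of fun i k =>
    fderiv ℝ (fderiv ℝ (fun y => φ (y, t))) x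
      (EuclideanSpace.single i 1) (EuclideanSpace.single k 1)

/-- The time derivative `φ_t(x,t)`. -/
def timeDeriv {N : ℕ} (φ : Space N × ℝ → ℝ) (x : Space N) (t : ℝ) : ℝ :=
  deriv (fun s => φ (x, s)) t

/-- The inner part of the Lévy–Itô operator, `𝒥¹_δ[x,t,φ]`. -/
def levyInner {N : ℕ} (μ : Measure (Space N)) (j : Space N → Space N → Space N) (δ : ℝ)
    (x : Space N) (t : ℝ) (φ : Space N × ℝ → ℝ) : ℝ :=
  ∫ z in {z : Space N | ‖z‖ ≤ δ}, jumpIncrement j x t (spaceGrad φ x t) φ z ∂μ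

/-- The outer part of the Lévy–Itô operator, `𝒥²_δ[x,t,p,u]`. -/
def levyOuter {N : ℕ} (μ : Measure (Space N)) (j : Space N → Space N → Space N) (δ : ℝ)
    (x : Space N) (t : ℝ) (p : Space N) (u : Space N × ℝ → ℝ) : ℝ :=
  ∫ z in {z : Space N | δ < ‖z‖}, jumpIncrement j x t p u z ∂μ

/-- `u` is a viscosity subsolution of `u_t + F(x, t, Du, D²u, 𝒥[x,t,u]) = 0` in the set `D` of
space-time. Test functions are `C²` and touch `u` from above globally on `ℝ^N × [0,T]`.
The outer integral is required to exist, since otherwise the inequality has no meaning; the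
inner one always exists. -/
def IsViscositySubsolution {N : ℕ} (T : ℝ) (μ : Measure (Space N))
    (j : Space N → Space N → Space N) (F : Nonlinearity N) (D : Set (Space N × ℝ))
    (u : Space N × ℝ → ℝ) : Prop :=
  UpperSemicontinuousOn u (strip N T) ∧
  ∀ φ : Space N × ℝ → ℝ, ContDiff ℝ 2 φ → ∀ x t, (x, t) ∈ D →
    IsMaxOn (fun P => u P - φ P) (strip N T) (x, t) →
    ∀ δ : ℝ, 0 < δ → δ < 1 →
      IntegrableOn (jumpIncrement j x t (spaceGrad φ x t) u) {z : Space N | δ < ‖z‖} μ ∧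
      timeDeriv φ x t + F x t (spaceGrad φ x t) (spaceHess φ x t)
        (levyInner μ j δ x t φ + levyOuter μ j δ x t (spaceGrad φ x t) u) ≤ 0

/-- Assumption `(E)`: `F` is continuous on `Ω × [0,T] × ℝ^N × 𝕊^N × ℝ` and degenerate
elliptic. -/
def AssumptionE {N : ℕ} (Ω : Set (Space N)) (T : ℝ) (F : Nonlinearity N) : Prop :=
  ContinuousOn
    (fun q : Space N × ℝ × Space N × Matrix (Fin N) (Fin N) ℝ × ℝ =>
      F q.1 q.2.1 q.2.2.1 q.2.2.2.1 q.2.2.2.2)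
    {q | q.1 ∈ Ω ∧ q.2.1 ∈ Icc 0 T ∧ q.2.2.2.1.IsSymm} ∧
  ∀ x ∈ Ω, ∀ t ∈ Icc 0 T, ∀ p : Space N, p ≠ 0 →
    ∀ X Y : Matrix (Fin N) (Fin N) ℝ, X.IsSymm → Y.IsSymm → (X - Y).PosSemidef →
    ∀ l₁ l₂ : ℝ, l₂ ≤ l₁ → F x t p X l₁ ≤ F x t p Y l₂

/-- The matrix `I - γ p ⊗ p`. -/
def rankOnePerturbation {N : ℕ} (γ : ℝ) (p : Space N) : Matrix (Fin N) (Fin N) ℝ :=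
  1 - γ • Matrix.vecMulVec p.ofLp p.ofLp

/-- The set `𝒞_{η,γ}(p) = {z : (1-η)|j(x,z)||p| ≤ |p · j(x,z)| ≤ 1/γ}`. -/
def jumpCone {N : ℕ} (j : Space N → Space N → Space N) (x : Space N) (η γ : ℝ)
    (p : Space N) : Set (Space N) :=
  {z | (1 - η) * ‖j x z‖ * ‖p‖ ≤ |inner ℝ p (j x z)| ∧ |inner ℝ p (j x z)| ≤ 1 / γ}

/-- Assumption `(S)`. -/
def AssumptionS {N : ℕ} (Ω : Set (Space N)) (T : ℝ) (F : Nonlinearity N) : Prop :=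
  ∀ xbar ∈ Ω, ∀ t₀ ∈ Ioo 0 T, ∃ R₀ > (0 : ℝ), ∃ ε₀ > (0 : ℝ), ∃ γ₀ > (0 : ℝ),
    ∀ R : ℝ, 0 < R → R < R₀ → ∀ ε : ℝ, 0 < ε → ε < ε₀ → ∀ γ ≥ γ₀,
      ∀ x ∈ Ω, ∀ t ∈ Icc 0 T, ‖x - xbar‖ ≤ R → |t - t₀| ≤ R →
        ∀ p : Space N, R / 2 ≤ ‖p‖ → ‖p‖ ≤ R → ∀ l : ℝ,
          ε * F x t p (rankOnePerturbation γ p) l ≤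
            F x t (ε • p) (ε • rankOnePerturbation γ p) (ε * l)

/-- Assumption `(S')`. -/
def AssumptionS' {N : ℕ} (Ω : Set (Space N)) (T : ℝ) (Cμ : ℝ) (F : Nonlinearity N) : Prop :=
  ∀ x₀ ∈ Ω, ∀ t₀ ∈ Ioc 0 T, ∃ r₀ > (0 : ℝ), ∃ ε₀ > (0 : ℝ),
    ∀ ε : ℝ, 0 < ε → ε < ε₀ → ∀ r : ℝ, 0 < r → r < r₀ →
      ∀ x ∈ Ω, ∀ t ∈ Icc 0 T, ‖x - x₀‖ ^ 2 + |t - t₀| ^ 2 < r ^ 2 →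
        ∀ p : Space N, ‖p‖ ≤ r → ∀ l ≤ Cμ,
          ε * F x t p 1 l ≤ F x t (ε • p) (ε • (1 : Matrix (Fin N) (Fin N) ℝ)) (ε * l)

/-- Assumption `(N_LI)`: the divergence to `+∞` as `γ → ∞` is uniform in `x`, `t`, `p`. -/
def AssumptionN {N : ℕ} (Ω : Set (Space N)) (T : ℝ) (μ : Measure (Space N))
    (j : Space N → Space N → Space N) (Cμ : ℝ) (F : Nonlinearity N) : Prop :=
  ∀ xbar ∈ Ω, ∀ t₀ ∈ Ioo 0 T, ∃ R₀ > (0 : ℝ), ∃ η : ℝ, 0 < η ∧ η < 1 ∧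
    ∀ R : ℝ, 0 < R → R < R₀ → ∀ c > (0 : ℝ), ∀ K : ℝ, ∀ᶠ γ : ℝ in atTop,
      ∀ x ∈ Ω, ∀ t ∈ Icc 0 T, ‖x - xbar‖ ≤ R → |t - t₀| ≤ R →
        ∀ p : Space N, R / 2 ≤ ‖p‖ → ‖p‖ ≤ R →
          K ≤ F x t p (rankOnePerturbation γ p)
            (Cμ - c * γ * ∫ z in jumpCone j x η γ p, |inner ℝ p (j x z)| ^ 2 ∂μ)

/-- Assumption `(N')`. -/
def AssumptionN' {N : ℕ} (Ω : Set (Space N)) (T : ℝ) (Cμ : ℝ) (F : Nonlinearity N) : Prop :=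
  ∀ x₀ ∈ Ω, ∀ t₀ ∈ Ioc 0 T, ∃ lam > (0 : ℝ), 0 < lam + F x₀ t₀ 0 1 Cμ

end

end LevyIto

open LevyIto

open LevyIto

/-! The set where `u` equals its maximum `M` is closed, and two local mechanisms make it spread. In
both, a barrier `ε h` vanishes at a contact point `P`, and the region `h ≤ 0` meets the contact set
only at `P`. For small `ε`, the maximum of `u - ε h` then lies near `P`
(`eventually_exists_isMaxOn_sub_smul`), and the viscosity inequality there is contradicted.

Horizontally (`horizontal_propagation`): if `u < M` at `(x₁, t₀)`, ellipsoids growing around that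
point first hit the contact set at a point off their vertical axis. There `h = k - exp (-γ d)`, with
`d` the quadratic form of a smaller ellipsoid tangent from inside. Its Hessian is a multiple of `I -
γ p ⊗ p`, and jumps in the cone around `p` contribute a nonlocal term at most `-cγ ∫ |p · j|²`. So
`(N_LI)` makes `F` outweigh the time derivative, while `(S)` absorbs the small factor
(`viscosity_exp_barrier`, `not_touching_ellipsoid`).

Vertically (`vertical_propagation`): if `u < M` just before `t₀`, the barrier is quadratic with time
slope `lam` at the pole `P`, and `(N')` and `(S')` contradict the inequality.

Alternating the two fills backward cylinders (`cylinder_propagation`), which then cover an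
admissible curve step by step. -/

/-- Perturbing `u` by a small multiple of `h`, the maximum is attained near the only contact
point of `u` with its maximum in the region `K` outside of which `h` is nonnegative. -/
lemma eventually_exists_isMaxOn_sub_smul {X : Type*} [TopologicalSpace X] {S K : Set X}
    {u h : X → ℝ} {M : ℝ} {P : X} (hu : UpperSemicontinuousOn u S) (hh : Continuous h)
    (hK : IsCompact K) (hKS : K ⊆ S) (hPK : P ∈ K) (huP : u P = M) (hM : ∀ Q ∈ S, u Q ≤ M)
    (hP : h P = 0) (hpos : ∀ Q ∈ S, Q ∉ K → 0 ≤ h Q) (hlt : ∀ Q ∈ K, Q ≠ P → u Q < M)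
    {U : Set X} (hU : IsOpen U) (hPU : P ∈ U) :
    ∃ ε₁ > (0 : ℝ), ∀ ε : ℝ, 0 < ε → ε < ε₁ →
      ∃ Q ∈ K, Q ∈ U ∧ IsMaxOn (fun P => u P - ε * h P) S Q ∧ M - u Q ≤ -(ε * h Q) := by
  obtain ⟨C, hC⟩ := hK.bddBelow_image hh.continuousOn
  have hC : ∀ Q ∈ K, C ≤ h Q := fun Q hQ => hC (mem_image_of_mem h hQ)
  obtain ⟨g, hg, hgap⟩ : ∃ g > (0 : ℝ), ∀ Q ∈ K \ U, u Q ≤ M - g := by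
    rcases (K \ U).eq_empty_or_nonempty with he | hne
    · exact ⟨1, one_pos, by simp [he]⟩
    · obtain ⟨Q, hQ, hQm⟩ := (hu.mono (sdiff_subset.trans hKS)).exists_isMaxOn hne (hK.diff hU)
      have hQP : Q ≠ P := fun e => hQ.2 (e ▸ hPU)
      refine ⟨M - u Q, sub_pos.2 (hlt Q hQ.1 hQP), fun Q' hQ' => ?_⟩
      have := hQm hQ'
      simp only [mem_ofPred_eq] at this
      linarith
  -- On `K \ U`, `u` is at most `M - g` and `h` at least `-(|C| + 1)`. This threshold keeps `u - ε
  -- h` below `M` there, which is its value at `P`.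
  refine ⟨g / (|C| + 1), by positivity, fun ε hε hε₁ => ?_⟩
  have hεC : ε * (|C| + 1) < g := (lt_div_iff₀ (by positivity)).1 hε₁
  have husc : UpperSemicontinuousOn (fun P => u P - ε * h P) K := by
    have h2 : UpperSemicontinuousOn (fun P => -(ε * h P)) K :=
      (by fun_prop : Continuous fun P => -(ε * h P)).continuousOn.upperSemicontinuousOn
    simpa [sub_eq_add_neg] using (hu.mono hKS).add h2
  obtain ⟨Q, hQ, hQm⟩ := husc.exists_isMaxOn ⟨P, hPK⟩ hK
  have hQM : M ≤ u Q - ε * h Q := by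
    have := hQm hPK
    simp only [mem_ofPred_eq, hP, huP] at this
    linarith
  refine ⟨Q, hQ, ?_, fun Q' hQ' => ?_, by linarith⟩
  · by_contra hQU
    have h1 := hgap Q ⟨hQ, hQU⟩
    have h2 : ε * -(|C| + 1) ≤ ε * h Q :=
      mul_le_mul_of_nonneg_left (by linarith [hC Q hQ, neg_abs_le C]) hε.le
    linarith
  · by_cases hK' : Q' ∈ K
    · exact hQm hK'
    · have h1 := hM Q' hQ'
      have h2 := mul_nonneg hε.le (hpos Q' hQ' hK')
      simp only [mem_ofPred_eq]
      linarith

/-! ### Derivatives of barriers `ψ (‖x - c‖² / 2 + θ t)`. -/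

section Radial

variable {N : ℕ} {ψ ψ' ψ'' θ : ℝ → ℝ} {c : Space N}

lemma hasFDerivAt_radial (h1 : ∀ s, HasDerivAt ψ (ψ' s) s) (a : ℝ) (x : Space N) :
    HasFDerivAt (fun y : Space N => ψ (‖y - c‖ ^ 2 / 2 + a))
      (ψ' (‖x - c‖ ^ 2 / 2 + a) • innerSL ℝ (x - c)) x := by
  have h2 : HasFDerivAt (fun y : Space N => ‖y - c‖ ^ 2 / 2 + a) (innerSL ℝ (x - c)) x := by
    have h3 := (((hasFDerivAt_id x).sub_const c).norm_sq.const_mul (1 / 2)).add_const a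
    refine (h3.congr_of_eventuallyEq (.of_forall fun y => ?_)).congr_fderiv ?_
    · simp; ring
    · ext v; simp
  exact (h1 _).comp_hasFDerivAt x h2

lemma spaceGrad_radial (h1 : ∀ s, HasDerivAt ψ (ψ' s) s) (x : Space N) (t : ℝ) :
    spaceGrad (fun P : Space N × ℝ => ψ (‖P.1 - c‖ ^ 2 / 2 + θ P.2)) x t =
      ψ' (‖x - c‖ ^ 2 / 2 + θ t) • (x - c) := by
  refine HasGradientAt.gradient ?_
  rw [hasGradientAt_iff_hasFDerivAt]
  refine (hasFDerivAt_radial h1 (θ t) x).congr_fderiv ?_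
  ext v
  simp

lemma timeDeriv_radial (h1 : ∀ s, HasDerivAt ψ (ψ' s) s) {θ' : ℝ} (x : Space N) (t : ℝ)
    (hθ : HasDerivAt θ θ' t) :
    timeDeriv (fun P : Space N × ℝ => ψ (‖P.1 - c‖ ^ 2 / 2 + θ P.2)) x t =
      ψ' (‖x - c‖ ^ 2 / 2 + θ t) * θ' :=
  ((h1 _).comp t (hθ.const_add (‖x - c‖ ^ 2 / 2))).deriv

/-- For the exponential profile `ψ'' = -γ ψ'`, so this matrix becomes `ψ'` times
`rankOnePerturbation γ (x - c)`, the form required by `(S)` and `(N_LI)`. -/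
lemma spaceHess_radial (hψ : ContDiff ℝ 2 ψ) (h1 : ∀ s, HasDerivAt ψ (ψ' s) s)
    (h2 : ∀ s, HasDerivAt ψ' (ψ'' s) s) (x : Space N) (t : ℝ) :
    spaceHess (fun P : Space N × ℝ => ψ (‖P.1 - c‖ ^ 2 / 2 + θ P.2)) x t =
      ψ' (‖x - c‖ ^ 2 / 2 + θ t) • (1 : Matrix (Fin N) (Fin N) ℝ) +
        ψ'' (‖x - c‖ ^ 2 / 2 + θ t) • Matrix.vecMulVec (x - c).ofLp (x - c).ofLp := by
  set a := θ t
  have hf : ContDiff ℝ 2 fun y : Space N => ψ (‖y - c‖ ^ 2 / 2 + a) :=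
    hψ.comp ((((contDiff_id.sub contDiff_const).norm_sq ℝ).div_const 2).add contDiff_const)
  have hd : DifferentiableAt ℝ (fderiv ℝ fun y : Space N => ψ (‖y - c‖ ^ 2 / 2 + a)) x :=
    ((hf.fderiv_right (m := 1) (by norm_num)).differentiable (by norm_num)) x
  ext i k
  have h3 : HasFDerivAt (fun y : Space N => ψ' (‖y - c‖ ^ 2 / 2 + a) * (y - c).ofLp k)
      (ψ' (‖x - c‖ ^ 2 / 2 + a) • EuclideanSpace.proj (𝕜 := ℝ) k +
        (x - c).ofLp k • (ψ'' (‖x - c‖ ^ 2 / 2 + a) • innerSL ℝ (x - c))) x :=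
    (hasFDerivAt_radial h2 a x).mul
      ((EuclideanSpace.proj (𝕜 := ℝ) k : Space N →L[ℝ] ℝ).hasFDerivAt.comp x
        ((hasFDerivAt_id x).sub_const c))
  have h4 := hd.hasFDerivAt.clm_apply (hasFDerivAt_const (EuclideanSpace.single k (1 : ℝ)) x)
  have h5 : (fun y : Space N => fderiv ℝ (fun y : Space N => ψ (‖y - c‖ ^ 2 / 2 + a)) y
      (EuclideanSpace.single k 1)) =
      fun y : Space N => ψ' (‖y - c‖ ^ 2 / 2 + a) * (y - c).ofLp k := by
    funext y
    rw [(hasFDerivAt_radial h1 a y).fderiv]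
    simp [EuclideanSpace.inner_single_right]
  rw [h5] at h4
  have h6 := congrArg (fun A : Space N →L[ℝ] ℝ => A (EuclideanSpace.single i 1))
    (h4.unique h3)
  simp [EuclideanSpace.inner_single_right] at h6
  simp only [spaceHess, Matrix.of_apply, Matrix.add_apply, Matrix.smul_apply, smul_eq_mul,
    Matrix.vecMulVec_apply]
  rw [h6, PiLp.sub_apply, PiLp.sub_apply, Matrix.one_apply]
  rcases eq_or_ne i k with rfl | hik
  · simp only [if_true]
    ring
  · rw [if_neg hik, if_neg hik.symm]
    ring

end Radial

/-! ### Bounds for the nonlocal operator. -/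

section Nonlocal

variable {N : ℕ} {μ : Measure (Space N)} {j : Space N → Space N → Space N}

/-- The function `1_B(z) |j(x,z)|² + 1_{Bᶜ}(z)`, whose integral is bounded in `(M_LI)`. -/
noncomputable def levyWeight (j : Space N → Space N → Space N) (x z : Space N) : ℝ :=
  (unitBall N).indicator (fun z => ‖j x z‖ ^ 2) z + (unitBall N)ᶜ.indicator 1 z

lemma levyWeight_of_lt (x : Space N) {z : Space N} (hz : ‖z‖ < 1) :
    levyWeight j x z = ‖j x z‖ ^ 2 := by
  have : z ∈ unitBall N := by simpa [unitBall] using hz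
  simp [levyWeight, this]

lemma levyWeight_of_ge (x : Space N) {z : Space N} (hz : 1 ≤ ‖z‖) :
    levyWeight j x z = 1 := by
  have : z ∉ unitBall N := by simpa [unitBall] using hz
  simp [levyWeight, this]

lemma levyWeight_nonneg (x z : Space N) : 0 ≤ levyWeight j x z := by
  rcases lt_or_ge ‖z‖ 1 with hz | hz
  · rw [levyWeight_of_lt x hz]; positivity
  · rw [levyWeight_of_ge x hz]; norm_num

lemma measurableSet_unitBall : MeasurableSet (unitBall N) := measurableSet_ball

lemma measurable_levyWeight {x : Space N} (hj : Measurable (j x)) :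
    Measurable (levyWeight j x) :=
  ((hj.norm.pow_const 2).indicator measurableSet_unitBall).add
    (measurable_one.indicator measurableSet_unitBall.compl)

lemma lintegral_levyWeight_le {Ω : Set (Space N)} {Cμ : ℝ} (hM : AssumptionM Ω μ j Cμ)
    {x : Space N} (hx : x ∈ Ω) :
    ∫⁻ z, ENNReal.ofReal (levyWeight j x z) ∂μ ≤ ENNReal.ofReal Cμ := by
  refine le_trans (le_of_eq ?_) (hM.2 x hx)
  rw [← lintegral_add_compl _ (measurableSet_unitBall (N := N))]
  congr 1
  · refine setLIntegral_congr_fun measurableSet_unitBall fun z hz => ?_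
    rw [levyWeight_of_lt x (by simpa [unitBall] using hz)]
  · rw [← setLIntegral_one]
    refine setLIntegral_congr_fun measurableSet_unitBall.compl fun z hz => ?_
    rw [levyWeight_of_ge x (by simpa [unitBall] using hz), ENNReal.ofReal_one]

lemma integrable_levyWeight {Ω : Set (Space N)} {Cμ : ℝ} (hM : AssumptionM Ω μ j Cμ)
    {x : Space N} (hx : x ∈ Ω) (hj : Measurable (j x)) : Integrable (levyWeight j x) μ := by
  refine ⟨(measurable_levyWeight hj).aestronglyMeasurable, ?_⟩
  rw [hasFiniteIntegral_iff_ofReal (.of_forall (levyWeight_nonneg x))]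
  exact (lintegral_levyWeight_le hM hx).trans_lt ENNReal.ofReal_lt_top

lemma integral_levyWeight_le {Ω : Set (Space N)} {Cμ : ℝ} (hM : AssumptionM Ω μ j Cμ)
    {x : Space N} (hx : x ∈ Ω) (hj : Measurable (j x)) : ∫ z, levyWeight j x z ∂μ ≤ Cμ := by
  rw [integral_eq_lintegral_of_nonneg_ae (.of_forall (levyWeight_nonneg x))
    (measurable_levyWeight hj).aestronglyMeasurable]
  exact ENNReal.toReal_le_of_le_ofReal hM.1.le (lintegral_levyWeight_le hM hx)

lemma measurable_jumpIncrement {x : Space N} (hj : Measurable (j x)) {φ : Space N × ℝ → ℝ}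
    (hφ : Continuous φ) (t : ℝ) (p : Space N) : Measurable (jumpIncrement j x t p φ) := by
  have h1 : Measurable fun z => φ (x + j x z, t) :=
    (by fun_prop : Continuous fun y => φ (x + y, t)).measurable.comp hj
  have h2 : Measurable fun z => inner ℝ p (cutJump j x z) :=
    (by fun_prop : Continuous fun y : Space N => inner ℝ p y).measurable.comp
      (hj.indicator measurableSet_unitBall)
  exact (h1.sub_const _).sub h2

/-- Maximality of `u - φ` bounds increments of `u` by those of `φ`, so on the shell `δ < ‖z‖ < 1`
the estimate for `φ` applies to `u`. Beyond the unit ball there is no compensator. The bound thus no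
longer depends on `δ`, which is free to be chosen for integrability. -/
lemma levyInner_add_levyOuter_le {T t δ : ℝ} {x : Space N} {u φ : Space N × ℝ → ℝ}
    {G : Space N → ℝ} (ht : t ∈ Icc 0 T) (hδ : δ < 1)
    (hmax : IsMaxOn (fun P => u P - φ P) (strip N T) (x, t)) (hG : Integrable G μ)
    (hG1 : ∀ z, ‖z‖ < 1 → jumpIncrement j x t (spaceGrad φ x t) φ z ≤ G z)
    (hG2 : ∀ z, 1 ≤ ‖z‖ → u (x + j x z, t) - u (x, t) ≤ G z)
    (hφi : IntegrableOn (jumpIncrement j x t (spaceGrad φ x t) φ) {z | ‖z‖ ≤ δ} μ)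
    (hui : IntegrableOn (jumpIncrement j x t (spaceGrad φ x t) u) {z | δ < ‖z‖} μ) :
    levyInner μ j δ x t φ + levyOuter μ j δ x t (spaceGrad φ x t) u ≤ ∫ z, G z ∂μ := by
  have hm1 : MeasurableSet {z : Space N | ‖z‖ ≤ δ} := measurableSet_le measurable_norm measurable_const
  have hc : {z : Space N | ‖z‖ ≤ δ}ᶜ = {z | δ < ‖z‖} := by ext z; simp
  rw [← integral_add_compl hm1 hG, hc]
  refine add_le_add (setIntegral_mono_on hφi hG.integrableOn hm1 fun z hz => hG1 z ?_)
    (setIntegral_mono_on hui hG.integrableOn (hc ▸ hm1.compl) fun z _ => ?_)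
  · exact lt_of_le_of_lt hz hδ
  · rcases lt_or_ge ‖z‖ 1 with hz | hz
    · refine le_trans ?_ (hG1 z hz)
      have := hmax (show (x + j x z, t) ∈ strip N T from ⟨mem_univ _, ht⟩)
      simp only [mem_ofPred_eq] at this
      simp only [jumpIncrement]
      linarith
    · have h0 : cutJump j x z = 0 := by
        simp only [cutJump]
        exact indicator_of_notMem (by simpa [unitBall] using hz) _
      simpa [jumpIncrement, h0] using hG2 z hz

lemma measurableSet_jumpCone {x : Space N} (hj : Measurable (j x)) (η γ : ℝ) (p : Space N) :
    MeasurableSet (jumpCone j x η γ p) := by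
  have h1 : Measurable fun z => |inner ℝ p (j x z)| :=
    (by fun_prop : Continuous fun y : Space N => |inner ℝ p y|).measurable.comp hj
  exact (measurableSet_le ((hj.norm.const_mul _).mul_const _) h1).inter
    (measurableSet_le h1 measurable_const)

/-- Large jumps need not be square integrable. Outside the unit ball it is the cap `1 / γ` in the
cone, together with the finite mass of `μ` there, that gives integrability. -/
lemma integrable_indicator_jumpCone {Ω : Set (Space N)} {Cμ : ℝ} (hM : AssumptionM Ω μ j Cμ)
    {x : Space N} (hx : x ∈ Ω) (hj : Measurable (j x)) (η γ : ℝ) (p : Space N) :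
    Integrable ((jumpCone j x η γ p).indicator fun z => |inner ℝ p (j x z)| ^ 2) μ := by
  have h1 : Measurable fun z => |inner ℝ p (j x z)| ^ 2 :=
    (by fun_prop : Continuous fun y : Space N => |inner ℝ p y| ^ 2).measurable.comp hj
  refine ((integrable_levyWeight hM hx hj).const_mul (‖p‖ ^ 2 + (1 / γ) ^ 2)).mono'
    (h1.indicator (measurableSet_jumpCone hj η γ p)).aestronglyMeasurable
    (.of_forall fun z => ?_)
  by_cases hz : z ∈ jumpCone j x η γ p
  · rw [indicator_of_mem hz, Real.norm_of_nonneg (by positivity)]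
    rcases lt_or_ge ‖z‖ 1 with hz1 | hz1
    · rw [levyWeight_of_lt x hz1]
      have := pow_le_pow_left₀ (abs_nonneg _) (abs_real_inner_le_norm p (j x z)) 2
      nlinarith [mul_nonneg (sq_nonneg (1 / γ)) (sq_nonneg ‖j x z‖)]
    · rw [levyWeight_of_ge x hz1]
      have := pow_le_pow_left₀ (abs_nonneg _) hz.2 2
      nlinarith [sq_nonneg ‖p‖]
  · rw [indicator_of_notMem hz, norm_zero]
    exact mul_nonneg (by positivity) (levyWeight_nonneg x z)

end Nonlocal

/-! ### Scalar inequalities for the exponential barrier. -/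

/-- Square `exp (-y / 2) ≥ 1 - y / 2`; the right side is nonnegative exactly when `y ≤ 2`. -/
lemma one_sub_exp_neg_le {y : ℝ} (hy : y ≤ 2) : 1 - Real.exp (-y) ≤ y - y ^ 2 / 4 := by
  have h1 : 1 - y / 2 ≤ Real.exp (-y / 2) := by
    linarith [Real.add_one_le_exp (-y / 2)]
  have h2 : Real.exp (-y) = Real.exp (-y / 2) ^ 2 := by
    rw [← Real.exp_nat_mul]; congr 1; push_cast; ring
  nlinarith [pow_le_pow_left₀ (by linarith) h1 2]

/-- Second order gain of the exponential barrier in directions of the cone: `a = p · j`,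
`b = |j|²`, `k = (1 - η)|p|`. -/
lemma one_sub_exp_neg_le_of_cone {γ a b k : ℝ} (hγ : 0 < γ) (hk : 0 ≤ k)
    (hγk : 1 ≤ γ * k ^ 2) (h1 : k * b ≤ |a|) (hb : 0 ≤ b) (h2 : |a| ≤ 1 / γ) :
    1 - Real.exp (-(γ * (a + b ^ 2 / 2))) - γ * a ≤ γ * (b ^ 2 / 2 - 1 / 16 * γ * |a| ^ 2) := by
  -- In the application `b` is the length `‖j‖`, so `a + b ^ 2 / 2` is the increment of `‖·‖ ^ 2 /
  -- 2`. The cone and the size of `γ` give `b ^ 2 ≤ |a|`, so the quadratic part cannot cancel more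
  -- than half of `a`. The factor `1 / 16` is this half squared, times the `1 / 4` of
  -- `one_sub_exp_neg_le`.
  have ha : γ * |a| ≤ 1 := by rwa [le_div_iff₀ hγ, mul_comm] at h2
  have h3 : (k * b) ^ 2 ≤ |a| ^ 2 := pow_le_pow_left₀ (by positivity) h1 2
  have hb2 : b ^ 2 ≤ γ * |a| ^ 2 := by nlinarith [sq_nonneg b]
  have hb1 : b ^ 2 ≤ |a| := by nlinarith [abs_nonneg a]
  have hy : γ * (a + b ^ 2 / 2) ≤ 2 := by nlinarith [le_abs_self a]
  have h4 := one_sub_exp_neg_le hy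
  have hb0 := sq_nonneg b
  have h5 : |a| / 2 ≤ |a + b ^ 2 / 2| := by
    rcases abs_cases a with h | h <;> rcases abs_cases (a + b ^ 2 / 2) with h' | h' <;> linarith
  have h6 : |a| ^ 2 / 4 ≤ (a + b ^ 2 / 2) ^ 2 := by
    rw [← sq_abs (a + b ^ 2 / 2)]; nlinarith [abs_nonneg a]
  have h7 : γ ^ 2 * (|a| ^ 2 / 4) ≤ γ ^ 2 * (a + b ^ 2 / 2) ^ 2 :=
    mul_le_mul_of_nonneg_left h6 (sq_nonneg γ)
  nlinarith

/-! ### The viscosity inequality for the two barriers. -/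

section Barrier

variable {N : ℕ} {μ : Measure (Space N)} {j : Space N → Space N → Space N}

/-- By continuity, the monotonicity of `F` in the nonlocal variable extends to `p = 0`. -/
lemma antitone_nonlocal (hN : 1 ≤ N) {Ω : Set (Space N)} {T : ℝ}
    {F : Nonlinearity N} (hE : AssumptionE Ω T F) {x : Space N} (hx : x ∈ Ω) {t : ℝ}
    (ht : t ∈ Icc 0 T) (p : Space N) {X : Matrix (Fin N) (Fin N) ℝ} (hX : X.IsSymm) {l₁ l₂ : ℝ}
    (hl : l₂ ≤ l₁) : F x t p X l₁ ≤ F x t p X l₂ := by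
  have hne : ∀ p : Space N, p ≠ 0 → F x t p X l₁ ≤ F x t p X l₂ := fun p hp =>
    hE.2 x hx t ht p hp X X hX hX (by simpa using Matrix.PosSemidef.zero) l₁ l₂ hl
  rcases eq_or_ne p 0 with rfl | hp
  · have hcont : ∀ l : ℝ, Continuous fun q : Space N => F x t q X l := fun l =>
      hE.1.comp_continuous (f := fun q : Space N => (x, t, q, X, l)) (by fun_prop)
        fun q => ⟨hx, ht, hX⟩
    -- In positive dimension `0` is a limit of nonzero gradients, so the inequality passes to the
    -- limit. It is needed when the quadratic barrier is touched on its axis.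
    have : Nonempty (Fin N) := ⟨⟨0, hN⟩⟩
    have : (𝓝[≠] (0 : Space N)).NeBot := Module.punctured_nhds_neBot ℝ (Space N) 0
    exact le_of_tendsto_of_tendsto ((hcont l₁).continuousAt.mono_left nhdsWithin_le_nhds)
      ((hcont l₂).continuousAt.mono_left nhdsWithin_le_nhds)
      (eventually_nhdsWithin_of_forall (s := {0}ᶜ) fun q hq => hne q hq)
  · exact hne p hp

lemma hasDerivAt_const_mul_sub_exp (ε k γ s : ℝ) :
    HasDerivAt (fun s => ε * (k - Real.exp (-(γ * s)))) (ε * γ * Real.exp (-(γ * s))) s := by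
  have h := ((((hasDerivAt_id s).const_mul γ).neg.exp).const_sub k).const_mul ε
  refine h.congr_deriv ?_
  simp; ring

lemma hasDerivAt_const_mul_exp (ε γ s : ℝ) :
    HasDerivAt (fun s => ε * γ * Real.exp (-(γ * s))) (-(ε * γ * Real.exp (-(γ * s)) * γ)) s := by
  have h := (((hasDerivAt_id s).const_mul γ).neg.exp).const_mul (ε * γ)
  refine h.congr_deriv ?_
  simp; ring

/-- Comparing Bochner integrals needs integrability of the test function's increment. For small `z`
the exponent changes by at most `1`, so Taylor's formula bounds the increment by a multiple of `‖j x
z‖ ^ 2`. -/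
lemma exists_integrableOn_jumpIncrement_exp {Ω : Set (Space N)} {Cμ : ℝ}
    (hM : AssumptionM Ω μ j Cμ) (hj : IsJumpFunction Ω j) {x y : Space N} (hx : x ∈ Ω)
    {ε k γ : ℝ} (hε : 0 < ε) (hγ : 0 < γ) {θ : ℝ → ℝ} (hθ : Continuous θ) (t : ℝ) :
    ∃ δ : ℝ, 0 < δ ∧ δ < 1 ∧ IntegrableOn (jumpIncrement j x t
      ((ε * γ * Real.exp (-(γ * (‖x - y‖ ^ 2 / 2 + θ t)))) • (x - y))
      (fun P => ε * (k - Real.exp (-(γ * (‖P.1 - y‖ ^ 2 / 2 + θ P.2)))))) {z | ‖z‖ ≤ δ} μ := by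
  obtain ⟨hjm, C₀, hC₀, hjC⟩ := hj
  set p := x - y with hp
  set E := Real.exp (-(γ * (‖p‖ ^ 2 / 2 + θ t))) with hEd
  have hE0 : 0 < E := Real.exp_pos _
  -- The two summands make the jump and the exponent change `w` below both at most `1` in size when
  -- `‖z‖ ≤ δ`.
  set c := (1 + γ * (‖p‖ + 1)) * C₀ with hc
  have hc0 : 0 < c := by positivity
  set δ := 1 / (2 + c) with hδ
  have hδ0 : 0 < δ := by positivity
  have hδ1 : δ < 1 := by rw [hδ, div_lt_one (by positivity)]; linarith
  have hcδ : c * δ ≤ 1 := by rw [hδ, mul_one_div, div_le_one (by positivity)]; linarith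
  refine ⟨δ, hδ0, hδ1, ?_⟩
  have hG := (integrable_levyWeight hM hx (hjm x hx)).const_mul
    (ε * E * ((γ * (‖p‖ + 1)) ^ 2 + γ / 2))
  refine Integrable.mono' hG.integrableOn
    (measurable_jumpIncrement (hjm x hx) (by fun_prop) t _).aestronglyMeasurable
    ((ae_restrict_iff' (measurableSet_le measurable_norm measurable_const)).2
      (.of_forall fun z hz => ?_))
  have hz : ‖z‖ ≤ δ := hz
  have hz1 : ‖z‖ < 1 := hz.trans_lt hδ1
  have hzB : z ∈ unitBall N := by simpa [unitBall] using hz1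
  have hcut : cutJump j x z = j x z := indicator_of_mem hzB _
  have hjz : (1 + γ * (‖p‖ + 1)) * ‖j x z‖ ≤ 1 := by
    refine le_trans ?_ hcδ
    rw [hc, mul_assoc]
    refine mul_le_mul_of_nonneg_left ((hjC x hx z).trans ?_) (by positivity)
    exact mul_le_mul_of_nonneg_left hz hC₀.le
  set v := j x z
  have hv0 := norm_nonneg v
  have hv1 : ‖v‖ ≤ 1 := by
    have : 0 ≤ γ * (‖p‖ + 1) * ‖v‖ := by positivity
    linarith
  set w := γ * (inner ℝ p v + ‖v‖ ^ 2 / 2) with hw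
  have hwv : |w| ≤ γ * (‖p‖ + 1) * ‖v‖ := by
    rw [hw, abs_mul, abs_of_pos hγ, mul_assoc]
    refine mul_le_mul_of_nonneg_left ?_ hγ.le
    refine (abs_add_le _ _).trans ?_
    have h1 := abs_real_inner_le_norm p v
    rw [abs_of_nonneg (by positivity : 0 ≤ ‖v‖ ^ 2 / 2)]
    nlinarith
  have hw1 : |-w| ≤ 1 := by rw [abs_neg]; linarith
  have hexp := Real.abs_exp_sub_one_sub_id_le hw1
  have hsplit : Real.exp (-(γ * (‖x + v - y‖ ^ 2 / 2 + θ t))) = E * Real.exp (-w) := by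
    rw [hEd, ← Real.exp_add, show x + v - y = p + v by rw [hp]; abel, norm_add_sq_real]
    congr 1; rw [hw]; ring
  have hval : jumpIncrement j x t ((ε * γ * E) • p)
      (fun P => ε * (k - Real.exp (-(γ * (‖P.1 - y‖ ^ 2 / 2 + θ P.2))))) z =
      ε * E * (-(Real.exp (-w) - 1 - -w) + γ / 2 * ‖v‖ ^ 2) := by
    simp only [jumpIncrement, hcut, inner_smul_left]
    rw [show x + j x z - y = x + v - y from rfl, hsplit, ← hp, ← hEd]
    simp [hw, v]; ring
  rw [hval, levyWeight_of_lt x hz1, Real.norm_eq_abs, abs_mul, abs_of_pos (by positivity),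
    mul_assoc (ε * E)]
  refine mul_le_mul_of_nonneg_left ((abs_add_le _ _).trans ?_) (by positivity)
  rw [abs_neg, abs_of_nonneg (by positivity : 0 ≤ γ / 2 * ‖v‖ ^ 2), add_mul]
  have h3 := pow_le_pow_left₀ (abs_nonneg w) hwv 2
  rw [sq_abs, mul_pow _ ‖v‖] at h3
  change _ ≤ (γ * (‖p‖ + 1)) ^ 2 * ‖v‖ ^ 2 + γ / 2 * ‖v‖ ^ 2
  rw [neg_sq] at hexp
  linarith

/-- The viscosity inequality tested with the exponential barrier. -/
lemma viscosity_exp_barrier {Ω : Set (Space N)} {T : ℝ} {Cμ : ℝ}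
    {F : Nonlinearity N} {D : Set (Space N × ℝ)} {u : Space N × ℝ → ℝ}
    (hu : IsViscositySubsolution T μ j F D u)
    (hM : AssumptionM Ω μ j Cμ) (hj : IsJumpFunction Ω j) (hE : AssumptionE Ω T F)
    {M : ℝ} (huM : ∀ Q ∈ strip N T, u Q ≤ M) {x y : Space N} {t : ℝ} (hx : x ∈ Ω)
    (ht : t ∈ Icc 0 T) (hD : (x, t) ∈ D) (hxy : x ≠ y)
    {ε k γ η : ℝ} (hε : 0 < ε) (hk : 0 ≤ k) (hγ : 2 ≤ γ) (hη : η < 1)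
    (hγη : 1 ≤ γ * ((1 - η) * ‖x - y‖) ^ 2)
    {θ : ℝ → ℝ} (hθ : ContDiff ℝ 2 θ) {θ' : ℝ} (hθ' : HasDerivAt θ θ' t)
    (hmax : IsMaxOn (fun P => u P - ε * (k - Real.exp (-(γ * (‖P.1 - y‖ ^ 2 / 2 + θ P.2)))))
      (strip N T) (x, t))
    (huP : M - u (x, t) ≤ -(ε * (k - Real.exp (-(γ * (‖x - y‖ ^ 2 / 2 + θ t)))))) :
    ∃ α : ℝ, 0 < α ∧ α = ε * γ * Real.exp (-(γ * (‖x - y‖ ^ 2 / 2 + θ t))) ∧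
      α * θ' + F x t (α • (x - y)) (α • rankOnePerturbation γ (x - y))
        (α * (Cμ - 1 / 16 * γ * ∫ z in jumpCone j x η γ (x - y), |inner ℝ (x - y) (j x z)| ^ 2 ∂μ))
        ≤ 0 := by
  have hγ0 : 0 < γ := by linarith
  set E := Real.exp (-(γ * (‖x - y‖ ^ 2 / 2 + θ t))) with hEd
  have hE0 : 0 < E := Real.exp_pos _
  set α := ε * γ * E with hα
  have hα0 : 0 < α := by positivity
  refine ⟨α, hα0, rfl, ?_⟩
  set p := x - y with hp
  have hp0 : p ≠ 0 := sub_ne_zero.2 hxy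
  obtain ⟨δ, hδ0, hδ1, hint⟩ :=
    exists_integrableOn_jumpIncrement_exp (k := k) (y := y) hM hj hx hε hγ0 hθ.continuous t
  rw [← hp, ← hEd, ← hα] at hint
  set ψ : ℝ → ℝ := fun s => ε * (k - Real.exp (-(γ * s))) with hψ
  have hψc : ContDiff ℝ 2 ψ := by fun_prop
  have hd1 := hasDerivAt_const_mul_sub_exp ε k γ
  have hd2 := hasDerivAt_const_mul_exp ε γ
  set φ : Space N × ℝ → ℝ := fun P => ψ (‖P.1 - y‖ ^ 2 / 2 + θ P.2) with hφ
  have hφc : ContDiff ℝ 2 φ :=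
    hψc.comp ((((contDiff_fst.sub contDiff_const).norm_sq ℝ).div_const 2).add
      (hθ.comp contDiff_snd))
  have hgrad : spaceGrad φ x t = α • p := spaceGrad_radial hd1 x t
  have htime : timeDeriv φ x t = α * θ' := timeDeriv_radial hd1 x t hθ'
  have hhess : spaceHess φ x t = α • rankOnePerturbation γ p := by
    refine (spaceHess_radial hψc hd1 hd2 x t).trans ?_
    rw [rankOnePerturbation, smul_sub, smul_smul, neg_smul, ← sub_eq_add_neg]
  obtain ⟨hui, hineq⟩ := hu.2 φ hφc x t hD hmax δ hδ0 hδ1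
  have hjx := hj.1 x hx
  have hCi := integrable_indicator_jumpCone hM hx hjx η γ p
  have hWi := integrable_levyWeight hM hx hjx
  set Z : Space N → ℝ := (jumpCone j x η γ p).indicator fun z => |inner ℝ p (j x z)| ^ 2 with hZ
  have hbound := levyInner_add_levyOuter_le (u := u) (φ := φ)
    (G := fun z => α * (levyWeight j x z - 1 / 16 * γ * Z z)) ht hδ1 hmax
    ((hWi.sub (hCi.const_mul _)).const_mul _) ?_ ?_ (hgrad ▸ hint) hui
  · rw [integral_const_mul, integral_sub hWi (hCi.const_mul _), integral_const_mul, hZ,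
      integral_indicator (measurableSet_jumpCone hjx η γ p)] at hbound
    have hl := hbound.trans (mul_le_mul_of_nonneg_left
      (sub_le_sub_right (integral_levyWeight_le hM hx hjx) _) hα0.le)
    have hsymm : (α • rankOnePerturbation γ p).IsSymm := by
      ext a b
      simp only [rankOnePerturbation, Matrix.transpose_apply, Matrix.smul_apply, Matrix.sub_apply,
        Matrix.vecMulVec_apply, Matrix.one_apply, smul_eq_mul, eq_comm (a := a)]
      ring
    have hmono := hE.2 x hx t ht (α • p) (smul_ne_zero hα0.ne' hp0) _ _ hsymm hsymm
      (by simpa using Matrix.PosSemidef.zero) _ _ hl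
    rw [htime, hgrad, hhess] at hineq
    rw [hgrad] at hmono
    linarith
  · intro z hz
    have hzB : z ∈ unitBall N := by simpa [unitBall] using hz
    have hcut : cutJump j x z = j x z := indicator_of_mem hzB _
    set v := j x z
    have hsplit : Real.exp (-(γ * (‖x + v - y‖ ^ 2 / 2 + θ t))) =
        E * Real.exp (-(γ * (inner ℝ p v + ‖v‖ ^ 2 / 2))) := by
      rw [hEd, ← Real.exp_add, show x + v - y = p + v by rw [hp]; abel, norm_add_sq_real]
      congr 1; ring
    have hval : jumpIncrement j x t (α • p) φ z =
        ε * E * (1 - Real.exp (-(γ * (inner ℝ p v + ‖v‖ ^ 2 / 2))) - γ * inner ℝ p v) := by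
      simp only [jumpIncrement, hcut, inner_smul_left, hφ, hψ]
      rw [hsplit, ← hp, ← hEd]
      simp [hα]; ring
    rw [hgrad, hval, levyWeight_of_lt x hz, hα,
      show ε * γ * E * (‖v‖ ^ 2 - 1 / 16 * γ * Z z) = ε * E * (γ * (‖v‖ ^ 2 - 1 / 16 * γ * Z z))
        by ring]
    refine mul_le_mul_of_nonneg_left ?_ (by positivity)
    have hv2 := sq_nonneg ‖v‖
    by_cases hzC : z ∈ jumpCone j x η γ p
    · rw [hZ, indicator_of_mem hzC]
      refine (one_sub_exp_neg_le_of_cone hγ0 (mul_nonneg (sub_pos.2 hη).le (norm_nonneg p)) hγη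
        (le_trans (le_of_eq (by ring)) hzC.1) (norm_nonneg v) hzC.2).trans ?_
      exact mul_le_mul_of_nonneg_left (by linarith) hγ0.le
    -- Off the cone, convexity `1 - exp (-y) ≤ y` suffices: the linear part cancels against the
    -- compensator.
    · rw [hZ, indicator_of_notMem hzC]
      have := Real.add_one_le_exp (-(γ * (inner ℝ p v + ‖v‖ ^ 2 / 2)))
      nlinarith
  -- For large jumps `u` gains at most `M - u (x, t) ≤ ε * E`. Since `γ ≥ 2`, the factor `1 - γ Z /
  -- 16` is at least `1 / 2`, and `α / 2 = ε * γ * E / 2` dominates that gain.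
  · intro z hz
    have h1 : u (x + j x z, t) ≤ M := huM _ ⟨mem_univ _, ht⟩
    have h2 : Z z ≤ (1 / γ) ^ 2 := by
      by_cases hzC : z ∈ jumpCone j x η γ p
      · rw [hZ, indicator_of_mem hzC]
        exact pow_le_pow_left₀ (abs_nonneg _) hzC.2 2
      · rw [hZ, indicator_of_notMem hzC]; positivity
    have h3 : γ * Z z ≤ 1 / γ := by
      refine (mul_le_mul_of_nonneg_left h2 hγ0.le).trans (le_of_eq ?_)
      field_simp
    have h4 : 1 / γ ≤ 1 / 2 := one_div_le_one_div_of_le two_pos hγ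
    rw [levyWeight_of_ge x hz, hα]
    have h5 : ε * E * (γ * (1 / 2)) ≤ ε * E * (γ * (1 - 1 / 16 * γ * Z z)) := by
      gcongr; linarith
    have h6 : 0 ≤ ε * k := by positivity
    have h7 : ε * E * 1 ≤ ε * E * (γ * (1 / 2)) := by gcongr; linarith
    nlinarith

/-- The viscosity inequality tested with a small convex quadratic barrier. -/
lemma viscosity_quadratic_barrier (hN : 1 ≤ N) {Ω : Set (Space N)} {T : ℝ} {Cμ : ℝ}
    {F : Nonlinearity N} {D : Set (Space N × ℝ)} {u : Space N × ℝ → ℝ}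
    (hu : IsViscositySubsolution T μ j F D u)
    (hM : AssumptionM Ω μ j Cμ) (hj : IsJumpFunction Ω j) (hE : AssumptionE Ω T F)
    {M : ℝ} (huM : ∀ Q ∈ strip N T, u Q ≤ M) {x y : Space N} {t : ℝ} (hx : x ∈ Ω)
    (ht : t ∈ Icc 0 T) (hD : (x, t) ∈ D) {ε : ℝ} (hε : 0 < ε)
    {θ : ℝ → ℝ} (hθ : ContDiff ℝ 2 θ) {θ' : ℝ} (hθ' : HasDerivAt θ θ' t)
    (hmax : IsMaxOn (fun P => u P - ε * (‖P.1 - y‖ ^ 2 / 2 + θ P.2)) (strip N T) (x, t))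
    (huP : M - u (x, t) ≤ ε) :
    ε * θ' + F x t (ε • (x - y)) (ε • (1 : Matrix (Fin N) (Fin N) ℝ)) (ε * Cμ) ≤ 0 := by
  set ψ : ℝ → ℝ := fun s => ε * s with hψ
  have hψc : ContDiff ℝ 2 ψ := by fun_prop
  have hd1 : ∀ s, HasDerivAt ψ ((fun _ => ε) s) s := fun s => by
    simpa using (hasDerivAt_id s).const_mul ε
  have hd2 : ∀ s : ℝ, HasDerivAt (fun _ : ℝ => ε) ((fun _ => 0) s) s := fun s =>
    hasDerivAt_const s ε
  set φ : Space N × ℝ → ℝ := fun P => ψ (‖P.1 - y‖ ^ 2 / 2 + θ P.2) with hφ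
  have hφc : ContDiff ℝ 2 φ :=
    hψc.comp ((((contDiff_fst.sub contDiff_const).norm_sq ℝ).div_const 2).add
      (hθ.comp contDiff_snd))
  have hgrad : spaceGrad φ x t = ε • (x - y) := spaceGrad_radial hd1 x t
  have htime : timeDeriv φ x t = ε * θ' := timeDeriv_radial hd1 x t hθ'
  have hhess : spaceHess φ x t = ε • (1 : Matrix (Fin N) (Fin N) ℝ) := by
    refine (spaceHess_radial hψc hd1 hd2 x t).trans ?_
    simp
  have hjx := hj.1 x hx
  have hWi := integrable_levyWeight hM hx hjx
  have hval : ∀ z, ‖z‖ < 1 → jumpIncrement j x t (spaceGrad φ x t) φ z = ε / 2 * ‖j x z‖ ^ 2 := by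
    intro z hz
    have hzB : z ∈ unitBall N := by simpa [unitBall] using hz
    have hcut : cutJump j x z = j x z := indicator_of_mem hzB _
    rw [hgrad]
    simp only [jumpIncrement, hcut, inner_smul_left, hφ, hψ]
    rw [show x + j x z - y = (x - y) + j x z by abel, norm_add_sq_real]
    simp; ring
  have hint : IntegrableOn (jumpIncrement j x t (spaceGrad φ x t) φ) {z | ‖z‖ ≤ 1 / 2} μ := by
    refine IntegrableOn.congr_fun (hWi.const_mul (ε / 2)).integrableOn (fun z hz => ?_)
      (measurableSet_le measurable_norm measurable_const)
    have hz : ‖z‖ ≤ 1 / 2 := hz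
    have hz1 : ‖z‖ < 1 := by linarith
    simp only [hval z hz1, levyWeight_of_lt x hz1]
  obtain ⟨hui, hineq⟩ := hu.2 φ hφc x t hD hmax (1 / 2) (by norm_num) (by norm_num)
  have hbound := levyInner_add_levyOuter_le (u := u) (φ := φ)
    (G := fun z => ε * levyWeight j x z) ht (by norm_num) hmax (hWi.const_mul _)
    (fun z hz => ?_) (fun z hz => ?_) hint hui
  · rw [integral_const_mul] at hbound
    have hl := hbound.trans (mul_le_mul_of_nonneg_left (integral_levyWeight_le hM hx hjx) hε.le)
    have hmono := antitone_nonlocal hN hE hx ht (ε • (x - y))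
      (X := ε • (1 : Matrix (Fin N) (Fin N) ℝ)) (Matrix.isSymm_one.smul ε) hl
    rw [htime, hgrad, hhess] at hineq
    rw [hgrad] at hmono
    linarith
  · rw [hval z hz, levyWeight_of_lt x hz]
    nlinarith [mul_nonneg hε.le (sq_nonneg ‖j x z‖)]
  · have h1 : u (x + j x z, t) ≤ M := huM _ ⟨mem_univ _, ht⟩
    rw [levyWeight_of_ge x hz]
    linarith

end Barrier

/-! ### Propagation of the contact set. -/

section Propagation

variable {N : ℕ}

lemma isClosed_strip (T : ℝ) : IsClosed (strip N T) := isClosed_univ.prod isClosed_Icc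

lemma isClosed_contactSet {T M : ℝ} {u : Space N × ℝ → ℝ}
    (hu : UpperSemicontinuousOn u (strip N T)) : IsClosed {P ∈ strip N T | M ≤ u P} := by
  obtain ⟨v, hv, he⟩ := upperSemicontinuousOn_iff_preimage_Ici.1 hu M
  have : {P ∈ strip N T | M ≤ u P} = strip N T ∩ v := he
  rw [this]
  exact (isClosed_strip T).inter hv

lemma isCompact_sublevel {T Q : ℝ} {θ : ℝ → ℝ} (hθ : Continuous θ) (y : Space N) :
    IsCompact {P ∈ strip N T | ‖P.1 - y‖ ^ 2 / 2 + θ P.2 ≤ Q} := by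
  obtain ⟨m, hm⟩ := (isCompact_Icc (a := (0 : ℝ)) (b := T)).bddBelow_image hθ.continuousOn
  have hcl : IsClosed {P : Space N × ℝ | ‖P.1 - y‖ ^ 2 / 2 + θ P.2 ≤ Q} :=
    isClosed_le (by fun_prop) continuous_const
  refine ((isCompact_closedBall y (2 * |Q - m| + 1)).prod
    (isCompact_Icc (a := (0 : ℝ)) (b := T))).of_isClosed_subset
    ((isClosed_strip T).inter hcl) ?_
  rintro ⟨x, t⟩ ⟨⟨-, ht⟩, h⟩
  refine ⟨?_, ht⟩
  have h1 : m ≤ θ t := hm (mem_image_of_mem θ ht)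
  have h2 := le_abs_self (Q - m)
  have h : ‖x - y‖ ^ 2 / 2 + θ t ≤ Q := h
  rw [mem_closedBall_iff_norm]
  change ‖x - y‖ ≤ _
  nlinarith [sq_nonneg (‖x - y‖ - 1), abs_nonneg (Q - m)]

/-- An ellipsoid and its image under a contraction towards a boundary point are tangent only
at that point. -/
lemma lt_of_internally_tangent_ellipsoid {x xb y : Space N} {t tb τ lam s : ℝ} (hlam : 0 < lam)
    (hs0 : 0 < s) (hs1 : s < 1) (hne : (x, t) ≠ (xb, tb))
    (h : ‖x - (xb - s • (xb - y))‖ ^ 2 / 2 + lam / 2 * (t - (tb - s * (tb - τ))) ^ 2 ≤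
      ‖xb - (xb - s • (xb - y))‖ ^ 2 / 2 + lam / 2 * (tb - (tb - s * (tb - τ))) ^ 2) :
    ‖x - y‖ ^ 2 / 2 + lam / 2 * (t - τ) ^ 2 < ‖xb - y‖ ^ 2 / 2 + lam / 2 * (tb - τ) ^ 2 := by
  obtain ⟨v, rfl⟩ : ∃ v, x = xb + v := ⟨x - xb, by abel⟩
  obtain ⟨w, rfl⟩ : ∃ w, y = xb - w := ⟨xb - y, by abel⟩
  obtain ⟨a, rfl⟩ : ∃ a, t = tb + a := ⟨t - tb, by ring⟩
  obtain ⟨b, rfl⟩ : ∃ b, τ = tb - b := ⟨tb - τ, by ring⟩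
  have e1 : xb + v - (xb - s • (xb - (xb - w))) = v + s • w := by
    rw [sub_sub_cancel]; abel
  have e2 : xb - (xb - s • (xb - (xb - w))) = s • w := by simp
  have e3 : xb + v - (xb - w) = v + w := by abel
  have e4 : xb - (xb - w) = w := by abel
  rw [e1, e2, norm_add_sq_real, inner_smul_right] at h
  rw [e3, e4, norm_add_sq_real]
  have hA : 0 < ‖v‖ ^ 2 + lam * a ^ 2 := by
    rcases eq_or_ne v 0 with rfl | hv
    · have ha : a ≠ 0 := by rintro rfl; simp at hne
      have := pow_pos (abs_pos.2 ha) 2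
      rw [sq_abs] at this
      positivity
    · have := norm_pos_iff.2 hv
      positivity
  set B := inner ℝ v w + lam * a * b with hB
  have h1 : ‖v‖ ^ 2 + lam * a ^ 2 + 2 * s * B ≤ 0 := by rw [hB]; nlinarith
  -- With `A = ‖v‖ ^ 2 + lam * a ^ 2 > 0` and `s < 1`, `s * (A + 2 * B) < A + 2 * s * B ≤ 0`.
  have h2 : s * (‖v‖ ^ 2 + lam * a ^ 2 + 2 * B) < 0 := by nlinarith
  have h3 : ‖v‖ ^ 2 + lam * a ^ 2 + 2 * B < 0 := by
    by_contra hc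
    exact absurd (mul_nonneg hs0.le (not_lt.1 hc)) (not_le.2 h2)
  rw [hB] at h3
  nlinarith

variable {Ω : Set (Space N)} {T : ℝ} {μ : Measure (Space N)} {j : Space N → Space N → Space N}
  {Cμ : ℝ} {F : Nonlinearity N} {u : Space N × ℝ → ℝ} {M : ℝ}

set_option maxHeartbeats 1000000 in
/-- An ellipsoid in which `u` stays below its maximum cannot touch the contact set away from its
vertical axis. -/
lemma not_touching_ellipsoid (hΩ : IsOpen Ω) (hj : IsJumpFunction Ω j)
    (hM : AssumptionM Ω μ j Cμ) (hE : AssumptionE Ω T F) (hS : AssumptionS Ω T F)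
    (hNLI : AssumptionN Ω T μ j Cμ F) (hu : IsViscositySubsolution T μ j F (Ω ×ˢ Ioo 0 T) u)
    (huM : ∀ Q ∈ strip N T, u Q ≤ M) {xb y₀ : Space N} {tb τ₀ lam : ℝ} (hlam : 0 < lam)
    (hxb : xb ∈ Ω) (htb : tb ∈ Ioo 0 T) (hub : u (xb, tb) = M) (hne : xb ≠ y₀)
    (hlt : ∀ P ∈ strip N T, ‖P.1 - y₀‖ ^ 2 / 2 + lam / 2 * (P.2 - τ₀) ^ 2 <
      ‖xb - y₀‖ ^ 2 / 2 + lam / 2 * (tb - τ₀) ^ 2 → u P < M) : False := by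
  obtain ⟨R₀, hR₀, ε₀, hε₀, γ₀, hγ₀, hS⟩ := hS xb hxb tb htb
  obtain ⟨R₁, hR₁, η, hη0, hη1, hNLI⟩ := hNLI xb hxb tb htb
  have hd : 0 < ‖xb - y₀‖ := norm_pos_iff.2 (sub_ne_zero.2 hne)
  -- Shrinking by `s` towards the contact point leaves it as the only one on the closed ellipsoid. A
  -- small `s` brings the centre close enough for the local assumptions.
  obtain ⟨s, hs0, hs⟩ : ∃ s > (0 : ℝ), s < min 1 (min R₀ R₁ / (2 * ‖xb - y₀‖)) :=
    exists_between (by positivity)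
  have hs1 : s < 1 := hs.trans_le (min_le_left _ _)
  have hsR : s * (2 * ‖xb - y₀‖) < min R₀ R₁ :=
    (lt_div_iff₀ (by positivity)).1 (hs.trans_le (min_le_right _ _))
  set y := xb - s • (xb - y₀) with hy
  set τ := tb - s * (tb - τ₀) with hτ
  -- Then `‖xb - y‖ = 3 / 4 * R` lies strictly between `R / 2` and `R`, so nearby gradients `x - y`
  -- stay in the annulus of `(S)` and `(N_LI)`.
  set R := 4 / 3 * (s * ‖xb - y₀‖) with hR
  have hsd : 0 < s * ‖xb - y₀‖ := by positivity
  have hRpos : 0 < R := by positivity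
  have hRR₀ : R < R₀ := by linarith [min_le_left R₀ R₁]
  have hRR₁ : R < R₁ := by linarith [min_le_right R₀ R₁]
  have hxy : ‖xb - y‖ = 3 / 4 * R := by
    rw [hy, sub_sub_cancel, norm_smul, Real.norm_of_nonneg hs0.le, hR]; ring
  set θ : ℝ → ℝ := fun t => lam / 2 * (t - τ) ^ 2 with hθ
  have hθc : ContDiff ℝ 2 θ := by fun_prop
  have hθ' : ∀ t, HasDerivAt θ (lam * (t - τ)) t := fun t => by
    refine ((((hasDerivAt_id t).sub_const τ).pow 2).const_mul (lam / 2)).congr_deriv ?_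
    simp; ring
  have hθcont := hθc.continuous
  set Q := ‖xb - y‖ ^ 2 / 2 + θ tb with hQ
  set K := {P ∈ strip N T | ‖P.1 - y‖ ^ 2 / 2 + θ P.2 ≤ Q} with hK
  set U : Set (Space N × ℝ) := {P | P.1 ∈ Ω} ∩ {P | P.2 ∈ Ioo 0 T} ∩ {P | ‖P.1 - xb‖ < R} ∩
    {P | |P.2 - tb| < R} ∩ {P | R / 2 < ‖P.1 - y‖} ∩ {P | ‖P.1 - y‖ < R} with hUd
  have hU : IsOpen U := by
    refine (((((hΩ.preimage continuous_fst).inter (isOpen_Ioo.preimage continuous_snd)).inter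
      (isOpen_lt ?_ ?_)).inter (isOpen_lt ?_ ?_)).inter (isOpen_lt ?_ ?_)).inter
      (isOpen_lt ?_ ?_) <;> fun_prop
  have hPU : (xb, tb) ∈ U := by
    refine ⟨⟨⟨⟨⟨hxb, htb⟩, ?_⟩, ?_⟩, ?_⟩, ?_⟩ <;> simp only [mem_ofPred_eq, hxy] <;>
      first | simpa using hRpos | linarith
  have hev : ∀ᶠ γ : ℝ in atTop, 1 ≤ γ * ((1 - η) * (R / 2)) ^ 2 :=
    (tendsto_id.atTop_mul_const
      (pow_pos (mul_pos (sub_pos.2 hη1) (half_pos hRpos)) 2)).eventually_ge_atTop 1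
  -- The level `lam * (T + |τ|) + 1` exceeds every possible `-lam * (t - τ)` by at least `1`. As `γ`
  -- is fixed before `ε`, the condition `ε < ε₀ / γ` later gives `α < ε₀`.
  obtain ⟨γ, hNγ, hγ0, hγ2, hγR⟩ :=
    ((hNLI R hRpos hRR₁ (1 / 16) (by norm_num) (lam * (T + |τ|) + 1)).and
      ((eventually_ge_atTop γ₀).and ((eventually_ge_atTop 2).and hev))).exists
  have hγpos : 0 < γ := by linarith
  set k := Real.exp (-(γ * Q)) with hk
  have hPS : (xb, tb) ∈ strip N T := ⟨mem_univ _, Ioo_subset_Icc_self htb⟩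
  obtain ⟨ε₁, hε₁, hcontact⟩ := eventually_exists_isMaxOn_sub_smul (K := K) (P := (xb, tb))
    (h := fun P : Space N × ℝ => k - Real.exp (-(γ * (‖P.1 - y‖ ^ 2 / 2 + θ P.2)))) hu.1
    (by fun_prop) (isCompact_sublevel hθcont y) (fun P hP => hP.1) ⟨hPS, le_rfl⟩ hub huM
    (by simp [hk, hQ])
    (fun P hP hPK => by
      have : Q < ‖P.1 - y‖ ^ 2 / 2 + θ P.2 := by
        by_contra hc
        exact hPK ⟨hP, not_lt.1 hc⟩
      simp only [hk, sub_nonneg, Real.exp_le_exp, neg_le_neg_iff]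
      exact mul_le_mul_of_nonneg_left this.le hγpos.le)
    (fun P hP hPne => hlt P hP.1
      (lt_of_internally_tangent_ellipsoid hlam hs0 hs1 hPne hP.2)) hU hPU
  obtain ⟨ε, hε0, hε⟩ : ∃ ε > (0 : ℝ), ε < min ε₁ (ε₀ / γ) := exists_between (by positivity)
  have hεγ : ε * γ < ε₀ := (lt_div_iff₀ hγpos).1 (hε.trans_le (min_le_right _ _))
  obtain ⟨⟨x, t⟩, -, ⟨⟨⟨⟨⟨hx, ht⟩, hxR⟩, htR⟩, hpR⟩, hpR'⟩, hmax, hval⟩ :=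
    hcontact ε hε0 (hε.trans_le (min_le_left _ _))
  simp only [mem_ofPred_eq] at hx ht hxR htR hpR hpR'
  have htI := Ioo_subset_Icc_self ht
  have hxy0 : x ≠ y := by
    rintro rfl
    simp at hpR; linarith
  have hγη : 1 ≤ γ * ((1 - η) * ‖x - y‖) ^ 2 := by
    refine hγR.trans ?_
    have : 0 ≤ 1 - η := by linarith
    gcongr
  obtain ⟨α, hα0, hα, hineq⟩ := viscosity_exp_barrier hu hM hj hE huM hx htI ⟨hx, ht⟩ hxy0 hε0
    (Real.exp_pos _).le hγ2 hη1 hγη hθc (hθ' t) hmax hval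
  have hexp : Real.exp (-(γ * (‖x - y‖ ^ 2 / 2 + θ t))) ≤ 1 := by
    rw [Real.exp_le_one_iff, neg_nonpos]
    simp only [hθ]; positivity
  have hαε : α < ε₀ := by
    rw [hα]
    exact (mul_le_of_le_one_right (by positivity) hexp).trans_lt hεγ
  have h1 := hS R hRpos hRR₀ α hα0 hαε γ hγ0 x hx t htI hxR.le htR.le (x - y) hpR.le hpR'.le
    (Cμ - 1 / 16 * γ * ∫ z in jumpCone j x η γ (x - y), |inner ℝ (x - y) (j x z)| ^ 2 ∂μ)
  have h2 := hNγ x hx t htI hxR.le htR.le (x - y) hpR.le hpR'.le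
  have h3 : -(lam * (T + |τ|)) ≤ lam * (t - τ) := by
    nlinarith [htI.1, htI.2, le_abs_self τ]
  have h4 := mul_le_mul_of_nonneg_left h2 hα0.le
  nlinarith

/-- Local horizontal propagation of maxima. -/
lemma horizontal_propagation (hΩ : IsOpen Ω) (hj : IsJumpFunction Ω j)
    (hM : AssumptionM Ω μ j Cμ) (hE : AssumptionE Ω T F) (hS : AssumptionS Ω T F)
    (hNLI : AssumptionN Ω T μ j Cμ F) (hu : IsViscositySubsolution T μ j F (Ω ×ˢ Ioo 0 T) u)
    (huM : ∀ Q ∈ strip N T, u Q ≤ M) {x₀ : Space N} {t₀ r : ℝ}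
    (hr : Metric.closedBall x₀ (2 * r) ⊆ Ω) (ht₀ : t₀ ∈ Ioo 0 T) (hu₀ : u (x₀, t₀) = M)
    {x₁ : Space N} (hx₁ : ‖x₁ - x₀‖ ≤ r) : u (x₁, t₀) = M := by
  by_contra hne
  have hS₁ : (x₁, t₀) ∈ strip N T := ⟨mem_univ _, Ioo_subset_Icc_self ht₀⟩
  have hlt : u (x₁, t₀) < M := lt_of_le_of_ne (huM _ hS₁) hne
  obtain ⟨σ, hσ0, hσI, hσ⟩ : ∃ σ > (0 : ℝ), (∀ t, |t - t₀| ≤ σ → t ∈ Ioo 0 T) ∧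
      ∀ t, |t - t₀| ≤ σ → u (x₁, t) < M := by
    have hopen : IsOpen {P ∈ strip N T | M ≤ u P}ᶜ := (isClosed_contactSet hu.1).isOpen_compl
    have hopen' : IsOpen ((fun t : ℝ => (x₁, t)) ⁻¹' {P ∈ strip N T | M ≤ u P}ᶜ ∩ Ioo 0 T) :=
      (hopen.preimage (by fun_prop)).inter isOpen_Ioo
    obtain ⟨σ, hσ0, hσ⟩ := Metric.nhds_basis_closedBall.mem_iff.1
      (hopen'.mem_nhds ⟨fun h => absurd h.2 (not_le.2 hlt), ht₀⟩)
    refine ⟨σ, hσ0, fun t ht => (hσ (by simpa [Real.dist_eq] using ht)).2, fun t ht => ?_⟩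
    have h := hσ (show t ∈ Metric.closedBall t₀ σ by simpa [Real.dist_eq] using ht)
    by_contra hc
    exact h.1 ⟨⟨mem_univ _, Ioo_subset_Icc_self h.2⟩, not_lt.1 hc⟩
  have hx01 : x₀ ≠ x₁ := by
    rintro rfl
    exact hne hu₀
  have hd : 0 < ‖x₀ - x₁‖ := norm_pos_iff.2 (sub_ne_zero.2 hx01)
  -- The ellipsoid through `(x₀, t₀)` then has vertical half-axis `σ`, so its axis stays where `u <
  -- M`.
  set lam := ‖x₀ - x₁‖ ^ 2 / σ ^ 2 with hlamd
  have hlam : 0 < lam := by positivity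
  set d : Space N × ℝ → ℝ := fun P => ‖P.1 - x₁‖ ^ 2 / 2 + lam / 2 * (P.2 - t₀) ^ 2 with hdd
  have hdc : Continuous d := by fun_prop
  have hK : IsCompact ({P ∈ strip N T | d P ≤ ‖x₀ - x₁‖ ^ 2 / 2} ∩ {P ∈ strip N T | M ≤ u P}) :=
    (isCompact_sublevel (θ := fun t => lam / 2 * (t - t₀) ^ 2) (by fun_prop) x₁).inter_right
      (isClosed_contactSet hu.1)
  have hS₀ : (x₀, t₀) ∈ strip N T := ⟨mem_univ _, Ioo_subset_Icc_self ht₀⟩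
  -- This is the first contact of the growing ellipsoids: minimality keeps the contact set out of
  -- the interior.
  obtain ⟨⟨xb, tb⟩, ⟨⟨hPS, hPd⟩, -, hPM⟩, hmin⟩ := hK.exists_isMinOn
    ⟨(x₀, t₀), ⟨hS₀, by simp [hdd]⟩, hS₀, hu₀.ge⟩ hdc.continuousOn
  have hPd' : ‖xb - x₁‖ ^ 2 / 2 + lam / 2 * (tb - t₀) ^ 2 ≤ ‖x₀ - x₁‖ ^ 2 / 2 := hPd
  have htb : |tb - t₀| ≤ σ := by
    refine abs_le_of_sq_le_sq ?_ hσ0.le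
    have h1 : lam * (tb - t₀) ^ 2 ≤ lam * σ ^ 2 := by
      have : lam * σ ^ 2 = ‖x₀ - x₁‖ ^ 2 := by rw [hlamd]; field_simp
      nlinarith [sq_nonneg ‖xb - x₁‖]
    exact le_of_mul_le_mul_left h1 hlam
  have hxb : ‖xb - x₁‖ ≤ ‖x₀ - x₁‖ := by
    refine le_of_sq_le_sq ?_ hd.le
    have : 0 ≤ lam / 2 * (tb - t₀) ^ 2 := by positivity
    linarith
  have hxbΩ : xb ∈ Ω := by
    refine hr ?_
    rw [mem_closedBall_iff_norm]
    have := norm_sub_le_norm_sub_add_norm_sub xb x₁ x₀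
    rw [norm_sub_rev x₀ x₁] at hxb
    linarith
  refine not_touching_ellipsoid hΩ hj hM hE hS hNLI hu huM hlam hxbΩ (hσI tb htb)
    (le_antisymm (huM _ hPS) hPM) (y₀ := x₁) (τ₀ := t₀) ?_ fun P hP hPlt => ?_
  · rintro rfl
    exact absurd hPM (not_le.2 (hσ tb htb))
  · by_contra hc
    exact absurd (hmin ⟨⟨hP, (le_of_lt hPlt).trans hPd⟩, hP, not_lt.1 hc⟩) (not_le.2 hPlt)

/-- Local vertical propagation of maxima: the maximum is attained at earlier nearby points. -/
lemma vertical_propagation (hN : 1 ≤ N) (hΩ : IsOpen Ω) (hj : IsJumpFunction Ω j)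
    (hM : AssumptionM Ω μ j Cμ) (hE : AssumptionE Ω T F) (hS' : AssumptionS' Ω T Cμ F)
    (hN' : AssumptionN' Ω T Cμ F) {t₀ : ℝ}
    (hu : IsViscositySubsolution T μ j F (Ω ×ˢ Ioc 0 t₀) u)
    (huM : ∀ Q ∈ strip N T, u Q ≤ M) {x₀ : Space N}
    (hx₀ : x₀ ∈ Ω) (ht₀ : t₀ ∈ Ioc 0 T) (hu₀ : u (x₀, t₀) = M) {r : ℝ} (hr : 0 < r) :
    ∃ x t, ‖x - x₀‖ < r ∧ t₀ - r < t ∧ 0 < t ∧ t < t₀ ∧ u (x, t) = M := by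
  by_contra! hcon
  obtain ⟨r₁, hr₁, hball⟩ := Metric.isOpen_iff.1 hΩ x₀ hx₀
  obtain ⟨lam, hlam, hpos⟩ := hN' x₀ hx₀ t₀ ht₀
  obtain ⟨r₀, hr₀, ε₀, hε₀, hS'⟩ := hS' x₀ hx₀ t₀ ht₀
  set ρ := min r (min r₁ t₀) with hρd
  have hρ : 0 < ρ := lt_min hr (lt_min hr₁ ht₀.1)
  have hρr : ρ ≤ r := min_le_left _ _
  have hρr₁ : ρ ≤ r₁ := (min_le_right _ _).trans (min_le_left _ _)
  have hρt : ρ ≤ t₀ := (min_le_right _ _).trans (min_le_right _ _)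
  -- The first two conditions confine `θ t + ‖x - x₀‖ ^ 2 / 2 ≤ 0` to height and radius below `ρ`.
  -- The third keeps the barrier above `-1`, so the deficit `M - u` is at most `ε`. This region is
  -- an ellipsoid with top `(x₀, t₀)`, so no test point lies after `t₀`.
  obtain ⟨κ, hκ1, hκ2, hκ3, hκ0⟩ : ∃ κ : ℝ, lam < κ * ρ ∧ 2 * lam ^ 2 < κ * ρ ^ 2 ∧
      lam ^ 2 ≤ κ ∧ 0 < κ :=
    (((tendsto_id.atTop_mul_const hρ).eventually_gt_atTop lam).and
      (((tendsto_id.atTop_mul_const (pow_pos hρ 2)).eventually_gt_atTop (2 * lam ^ 2)).and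
        ((eventually_ge_atTop (lam ^ 2)).and (eventually_gt_atTop 0)))).exists
  set θ : ℝ → ℝ := fun t => lam * (t - t₀) + κ * (t - t₀) ^ 2 with hθ
  have hθc : ContDiff ℝ 2 θ := by fun_prop
  have hθ' : ∀ t, HasDerivAt θ (lam + 2 * κ * (t - t₀)) t := fun t => by
    have h := ((hasDerivAt_id t).sub_const t₀).const_mul lam
    refine (h.add ((((hasDerivAt_id t).sub_const t₀).pow 2).const_mul κ)).congr_deriv ?_
    simp; ring
  have hθcont := hθc.continuous
  set K := {P ∈ strip N T | ‖P.1 - x₀‖ ^ 2 / 2 + θ P.2 ≤ 0} with hK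
  have hKprop : ∀ x t, (x, t) ∈ K → ‖x - x₀‖ < ρ ∧ t₀ - ρ < t ∧ t ≤ t₀ ∧
      (t = t₀ → x = x₀) := by
    rintro x t ⟨-, h⟩
    have h : ‖x - x₀‖ ^ 2 / 2 + (lam * (t - t₀) + κ * (t - t₀) ^ 2) ≤ 0 := h
    have hn := sq_nonneg ‖x - x₀‖
    have hle : t ≤ t₀ := by
      by_contra hc
      have hc' : 0 < t - t₀ := by linarith
      have : 0 < lam * (t - t₀) + κ * (t - t₀) ^ 2 := by positivity
      linarith
    have hs : κ * (t₀ - t) ≤ lam := by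
      by_contra hc
      have h0 : 0 < t₀ - t := by
        rcases hle.eq_or_lt with rfl | h0
        · simp at hc; linarith
        · linarith
      nlinarith
    have hx : ‖x - x₀‖ ^ 2 < ρ ^ 2 := by
      have h1 : κ * ‖x - x₀‖ ^ 2 ≤ 2 * lam * (κ * (t₀ - t)) := by
        nlinarith [mul_nonneg hκ0.le (sq_nonneg (t - t₀))]
      have h2 : 2 * lam * (κ * (t₀ - t)) ≤ 2 * lam * lam := by gcongr
      refine lt_of_mul_lt_mul_left (a := κ) ?_ hκ0.le
      nlinarith
    refine ⟨lt_of_pow_lt_pow_left₀ 2 hρ.le hx, ?_, hle, ?_⟩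
    · have : κ * (t₀ - t) < κ * ρ := by linarith
      linarith [lt_of_mul_lt_mul_left this hκ0.le]
    · rintro rfl
      simp only [sub_self] at h
      have : ‖x - x₀‖ = 0 := by nlinarith
      exact sub_eq_zero.1 (norm_eq_zero.1 this)
  have hcont : ContinuousWithinAt (fun P : Space N × ℝ =>
      lam + 2 * κ * (P.2 - t₀) + F P.1 P.2 (P.1 - x₀) 1 Cμ) (Ω ×ˢ Icc 0 T) (x₀, t₀) := by
    have h1 : ContinuousOn (fun P : Space N × ℝ => F P.1 P.2 (P.1 - x₀) 1 Cμ) (Ω ×ˢ Icc 0 T) :=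
      hE.1.comp (f := fun P : Space N × ℝ =>
        (P.1, P.2, P.1 - x₀, (1 : Matrix (Fin N) (Fin N) ℝ), Cμ)) (by fun_prop)
        fun P hP => ⟨hP.1, hP.2, Matrix.isSymm_one⟩
    have h2 : Continuous fun P : Space N × ℝ => lam + 2 * κ * (P.2 - t₀) := by fun_prop
    exact (h2.continuousOn.add h1) _ ⟨hx₀, Ioc_subset_Icc_self ht₀⟩
  obtain ⟨V, hV, hPV, hVpos⟩ := mem_nhdsWithin.1
    (hcont.eventually (lt_mem_nhds (show (0 : ℝ) < _ by simpa using hpos)))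
  set U : Set (Space N × ℝ) := V ∩ {P | ‖P.1 - x₀‖ ^ 2 + |P.2 - t₀| ^ 2 < (r₀ / 2) ^ 2} with hUd
  have hU : IsOpen U := hV.inter (isOpen_lt (by fun_prop) (by fun_prop))
  have hPU : (x₀, t₀) ∈ U := ⟨hPV, by simp; positivity⟩
  have hPS : (x₀, t₀) ∈ strip N T := ⟨mem_univ _, Ioc_subset_Icc_self ht₀⟩
  obtain ⟨ε₁, hε₁, hcontact⟩ := eventually_exists_isMaxOn_sub_smul (K := K) (P := (x₀, t₀))
    (h := fun P : Space N × ℝ => ‖P.1 - x₀‖ ^ 2 / 2 + θ P.2) hu.1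
    (by fun_prop) (isCompact_sublevel hθcont x₀) (fun P hP => hP.1)
    ⟨hPS, by simp [hθ]⟩ hu₀ huM (by simp [hθ])
    (fun P hP hPK => by
      by_contra hc
      exact hPK ⟨hP, (not_le.1 hc).le⟩)
    (fun P hP hPne => by
      obtain ⟨x, t⟩ := P
      obtain ⟨h1, h2, h3, h4⟩ := hKprop x t hP
      have h5 : t < t₀ := lt_of_le_of_ne h3 fun e => hPne (by rw [h4 e, e])
      exact lt_of_le_of_ne (huM _ hP.1)
        (hcon x t (h1.trans_le hρr) (by linarith) (by linarith) h5)) hU hPU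
  obtain ⟨ε, hε0, hε⟩ : ∃ ε > (0 : ℝ), ε < min ε₁ ε₀ := exists_between (lt_min hε₁ hε₀)
  obtain ⟨⟨x, t⟩, hxtK, ⟨hxtV, hxtr⟩, hmax, hval⟩ := hcontact ε hε0 (hε.trans_le (min_le_left _ _))
  obtain ⟨h1, h2, h3, -⟩ := hKprop x t hxtK
  have hx : x ∈ Ω := hball (by rw [mem_ball_iff_norm]; linarith)
  have ht0 : 0 < t := by linarith
  have htI : t ∈ Icc 0 T := ⟨ht0.le, h3.trans ht₀.2⟩
  have hxtr : ‖x - x₀‖ ^ 2 + |t - t₀| ^ 2 < (r₀ / 2) ^ 2 := hxtr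
  have hval' : M - u (x, t) ≤ ε := by
    refine hval.trans ?_
    have h5 : -1 ≤ ‖x - x₀‖ ^ 2 / 2 + (lam * (t - t₀) + κ * (t - t₀) ^ 2) := by
      have h6 : 0 ≤ κ * (1 + lam * (t - t₀) + κ * (t - t₀) ^ 2) := by
        nlinarith [sq_nonneg (2 * (κ * (t - t₀)) + lam), sq_nonneg lam]
      have h7 := nonneg_of_mul_nonneg_right h6 hκ0
      nlinarith [sq_nonneg ‖x - x₀‖]
    have h8 := mul_le_mul_of_nonneg_left h5 hε0.le
    simp only [hθ]
    linarith
  have hineq := viscosity_quadratic_barrier hN hu hM hj hE huM hx htI ⟨hx, ht0, h3⟩ hε0 hθc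
    (hθ' t) hmax hval'
  have hp : ‖x - x₀‖ ≤ r₀ / 2 := by
    refine le_of_sq_le_sq ?_ (by positivity)
    linarith [sq_nonneg |t - t₀|]
  have h4 := hS' ε hε0 (hε.trans_le (min_le_right _ _)) (r₀ / 2) (by positivity) (by linarith)
    x hx t htI hxtr (x - x₀) hp Cμ le_rfl
  have h5 : 0 < lam + 2 * κ * (t - t₀) + F x t (x - x₀) 1 Cμ := hVpos ⟨hxtV, hx, htI⟩
  nlinarith [mul_pos hε0 h5]

lemma viscosity_subsolution_mono {D D' : Set (Space N × ℝ)}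
    (hu : IsViscositySubsolution T μ j F D u) (h : D' ⊆ D) :
    IsViscositySubsolution T μ j F D' u :=
  ⟨hu.1, fun φ hφ x t hxt => hu.2 φ hφ x t (h hxt)⟩

/-- Maxima propagate to backward cylinders. -/
lemma cylinder_propagation (hN : 1 ≤ N) (hΩ : IsOpen Ω) (hj : IsJumpFunction Ω j)
    (hM : AssumptionM Ω μ j Cμ) (hE : AssumptionE Ω T F) (hS : AssumptionS Ω T F)
    (hS' : AssumptionS' Ω T Cμ F) (hNLI : AssumptionN Ω T μ j Cμ F)
    (hN' : AssumptionN' Ω T Cμ F) (hu : IsViscositySubsolution T μ j F (Ω ×ˢ Ioo 0 T) u)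
    {t₀ : ℝ} (hut : IsViscositySubsolution T μ j F (Ω ×ˢ Ioc 0 t₀) u)
    (huM : ∀ Q ∈ strip N T, u Q ≤ M) {x₀ : Space N} {r : ℝ} (hr : 0 < r)
    (hball : Metric.closedBall x₀ (5 * r) ⊆ Ω) (ht₀ : t₀ ∈ Ioc 0 T) (hu₀ : u (x₀, t₀) = M)
    {x : Space N} {t : ℝ} (hx : ‖x - x₀‖ < r) (ht : t ∈ Ioc 0 t₀) : u (x, t) = M := by
  -- The radius `5 * r` is `r` for a moved centre plus `2 * (2 * r)` for a horizontal move of length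
  -- `2 * r`.
  have hx₀ : x₀ ∈ Ω := hball (Metric.mem_closedBall_self (by positivity))
  have hhor : ∀ t ∈ Ioo 0 T, ∀ x, ‖x - x₀‖ < r → u (x, t) = M →
      ∀ x', ‖x' - x₀‖ < r → u (x', t) = M := by
    intro t ht x hx hxt x' hx'
    refine horizontal_propagation hΩ hj hM hE hS hNLI hu huM (r := 2 * r) ?_ ht hxt ?_
    · refine (Metric.closedBall_subset_closedBall' ?_).trans hball
      rw [dist_eq_norm]; linarith
    · have := norm_sub_le_norm_sub_add_norm_sub x' x₀ x
      rw [norm_sub_rev x₀ x] at this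
      linarith
  have hclosed := isClosed_contactSet (M := M) hu.1
  have hStrip : ∀ t, 0 < t → t ≤ t₀ → ∀ x : Space N, (x, t) ∈ strip N T := fun t h1 h2 x =>
    ⟨mem_univ _, h1.le, h2.trans ht₀.2⟩
  have hcentre : ∀ t ∈ Ioc 0 t₀, u (x₀, t) = M := by
    intro t ht
    -- The lowest contact time on the axis must be `t`: a vertical step would give an earlier
    -- contact nearby, and a horizontal step would return it to the axis.
    set G : Set ℝ := {s | (x₀, s) ∈ {P ∈ strip N T | M ≤ u P}} ∩ Icc t t₀ with hG
    have hGc : IsClosed G := (hclosed.preimage (by fun_prop)).inter isClosed_Icc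
    have hG0 : t₀ ∈ G := ⟨⟨hStrip t₀ ht₀.1 le_rfl x₀, hu₀.ge⟩, ht.2, le_rfl⟩
    have hGb : BddBelow G := ⟨t, fun s hs => hs.2.1⟩
    obtain ⟨⟨hbS, hbM⟩, htb, hbt₀⟩ := hGc.csInf_mem ⟨t₀, hG0⟩ hGb
    set b := sInf G with hb
    have hbeq : u (x₀, b) = M := le_antisymm (huM _ hbS) hbM
    have hb0 : 0 < b := ht.1.trans_le htb
    rcases htb.eq_or_lt with h | h
    · rwa [h]
    · obtain ⟨x, s, hxr, hs1, hs0, hsb, hus⟩ := vertical_propagation hN hΩ hj hM hE hS' hN'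
        (viscosity_subsolution_mono hut (prod_mono le_rfl (Ioc_subset_Ioc_right hbt₀))) huM hx₀
        ⟨hb0, hbt₀.trans ht₀.2⟩ hbeq (lt_min hr (sub_pos.2 h))
      have hts : t ≤ s := by
        have := min_le_right r (b - t)
        linarith
      have hu' := hhor s ⟨hs0, by linarith [ht₀.2]⟩ x (hxr.trans_le (min_le_left _ _)) hus x₀
        (by simpa using hr)
      have hsG : s ∈ G := ⟨⟨hStrip s hs0 (by linarith) x₀, hu'.ge⟩, hts, by linarith⟩
      exact absurd (csInf_le hGb hsG) (not_le.2 hsb)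
  have hbefore : ∀ t ∈ Ioo 0 t₀, u (x, t) = M := fun t ht =>
    hhor t ⟨ht.1, ht.2.trans_le ht₀.2⟩ x₀ (by simpa using hr)
      (hcentre t ⟨ht.1, ht.2.le⟩) x hx
  -- Horizontal propagation is unavailable at `t₀ = T`; the top slice follows by closedness of the
  -- contact set.
  have hsub : closure (Ioo 0 t₀) ⊆ {s | (x, s) ∈ {P ∈ strip N T | M ≤ u P}} :=
    closure_minimal (fun s hs => ⟨hStrip s hs.1 hs.2.le x, (hbefore s hs).ge⟩)
      (hclosed.preimage (by fun_prop))
  rw [closure_Ioo ht₀.1.ne] at hsub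
  exact le_antisymm (huM _ (hStrip t ht.1 ht.2 x)) (hsub ⟨ht.1.le, ht.2⟩).2

end Propagation

/-! ### Propagation along the curve. -/

theorem mainTheorem12 (N : ℕ) (hN : 1 ≤ N)
    (Ω : Set (Space N)) (hΩ : IsOpen Ω) (hΩb : Bornology.IsBounded Ω)
    (T : ℝ) (hT : 0 < T)
    (μ : Measure (Space N)) (hμ : IsLevyMeasure μ)
    (j : Space N → Space N → Space N) (hj : IsJumpFunction Ω j)
    (Cμ : ℝ) (hM : AssumptionM Ω μ j Cμ)
    (F : Nonlinearity N)
    (hE : AssumptionE Ω T F)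
    (hS : AssumptionS Ω T F) (hS' : AssumptionS' Ω T Cμ F)
    (hN_LI : AssumptionN Ω T μ j Cμ F) (hN' : AssumptionN' Ω T Cμ F)
    (u : Space N × ℝ → ℝ)
    (hu : IsViscositySubsolution T μ j F (Ω ×ˢ Ioo 0 T) u)
    (P₀ : Space N × ℝ) (hP₀ : P₀ ∈ parabolicCylinder Ω T)
    (huT : P₀.2 = T → IsViscositySubsolution T μ j F (Ω ×ˢ Ioc 0 T) u)
    (hmax : IsMaxOn u (strip N T) P₀) :
    ∀ Q ∈ reachableSet Ω T P₀, u Q = u P₀ := by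
  have huP₀ : IsViscositySubsolution T μ j F (Ω ×ˢ Ioc 0 P₀.2) u := by
    rcases hP₀.2.2.eq_or_lt with h | h
    · rw [h]; exact huT h
    · exact viscosity_subsolution_mono hu (prod_mono le_rfl fun s hs => ⟨hs.1, hs.2.trans_lt h⟩)
  have huM : ∀ Q ∈ strip N T, u Q ≤ u P₀ := fun Q hQ => hmax hQ
  rintro Q ⟨-, rfl | ⟨c, hc, -, hc0, hc1, hcQ, hmono⟩⟩
  · rfl
  have hstrip : ∀ s ∈ Icc (0 : ℝ) 1, c s ∈ strip N T := fun s hs =>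
    ⟨mem_univ _, Ioc_subset_Icc_self (hcQ s hs).2⟩
  -- The first contact parameter `b` is attained. If `b > 0`, slightly earlier points of the curve
  -- lie in a backward cylinder at `c b`, because time is monotone, and so are contacts too.
  set A : Set ℝ := Icc 0 1 ∩ c ⁻¹' {P ∈ strip N T | u P₀ ≤ u P} with hA
  have hAc : IsClosed A := hc.preimage_isClosed_of_isClosed isClosed_Icc (isClosed_contactSet hu.1)
  have hone : (1 : ℝ) ∈ Icc (0 : ℝ) 1 := ⟨zero_le_one, le_rfl⟩
  have hA1 : (1 : ℝ) ∈ A := ⟨hone, hstrip 1 hone, by rw [hc1]⟩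
  have hAb : BddBelow A := ⟨0, fun s hs => hs.1.1⟩
  obtain ⟨hbI, hbS, hbM⟩ := hAc.csInf_mem ⟨1, hA1⟩ hAb
  set b := sInf A with hb
  have hbu : u ((c b).1, (c b).2) = u P₀ := le_antisymm (huM _ hbS) hbM
  rcases hbI.1.eq_or_lt with h | h
  · rw [← hc0, h]; exact hbu
  exfalso
  obtain ⟨hbΩ, hbt⟩ := hcQ b hbI
  obtain ⟨r, hr, hball⟩ := Metric.nhds_basis_closedBall.mem_iff.1 (hΩ.mem_nhds hbΩ)
  have htle : (c b).2 ≤ P₀.2 := by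
    rw [← hc1]; exact hmono hbI hone hbI.2
  have hnear : ∀ᶠ s in 𝓝[Icc 0 1] b, ‖(c s).1 - (c b).1‖ < r / 5 := by
    have h1 : ContinuousWithinAt (fun s => ‖(c s).1 - (c b).1‖) (Icc 0 1) b :=
      ((continuous_fst.continuousAt.comp_continuousWithinAt (hc b hbI)).sub
        continuousWithinAt_const).norm
    exact h1.eventually (gt_mem_nhds (by simpa using by positivity))
  obtain ⟨ρ, hρ, hnear⟩ := Metric.mem_nhdsWithin_iff.1 hnear
  obtain ⟨s, hs1, hs2⟩ : ∃ s, max 0 (b - ρ) < s ∧ s < b :=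
    exists_between (max_lt h (by linarith))
  have hsI : s ∈ Icc (0 : ℝ) 1 := ⟨((le_max_left _ _).trans_lt hs1).le, hs2.le.trans hbI.2⟩
  have hsb : s ∈ Metric.ball b ρ := by
    have := (le_max_right 0 (b - ρ)).trans_lt hs1
    rw [Metric.mem_ball, Real.dist_eq, abs_lt]
    constructor <;> linarith
  have hsu : u ((c s).1, (c s).2) = u P₀ :=
    cylinder_propagation hN hΩ hj hM hE hS hS' hN_LI hN' hu
      (viscosity_subsolution_mono huP₀ (prod_mono le_rfl (Ioc_subset_Ioc_right htle))) huM
      (r := r / 5) (by positivity) (by rwa [mul_div_cancel₀ r (by norm_num : (5 : ℝ) ≠ 0)])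
      hbt hbu (hnear ⟨hsb, hsI⟩) ⟨(hcQ s hsI).2.1, hmono hsI hbI hs2.le⟩
  exact absurd (csInf_le hAb ⟨hsI, hstrip s hsI, hsu.ge⟩) (not_le.2 hs2)
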